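/- Let $d\ge 1$ and let $V$ be a real inner product space of finite dimension $n$ with an orthonormal basis $e_{v,1},\dots,e_{v,n}$. Let $\mathrm{Lip}(\square^d,V)$ be the set of Lipschitz maps from $\square^d=[0,1]^d$ to $V$. For $\mathbf x\in \mathrm{Lip}(\square^d,V)$ and an order-preserving injection $P:[d]\to[n]$ (write $P\in\mathcal O_{d,n}$) let $J[\mathbf x_P]=\det\big(\partial x_{P(i)}/\partial s_j\big)_{i,j}$, which is defined almost everywhere by Rademacher's theorem, and let $\hat d\mathbf x=(J[\mathbf x_P])_{P\in\mathcal O_{d,n}}\in L^\infty(\square^d,\Lambda^dV)$, where the $e^P=e_{v,P(1)}\wedge\dots\wedge e_{v,P(d)}$ form an orthonormal basis of $\Lambda^dV$. Maps with the same $\hat d\mathbf x$ are called Jacobian equivalent. $\mathrm{Lip}_J(\square^d,V)$ is the set of equivalence classes, with the metric $\mu_\infty(\mathbf x,\mathbf y)=\|\hat d\mathbf x-\hat d\mathbf y\|_\infty$. Let $\overline V_d=\mathbb R^d\times V$, with the standard basis of $\mathbb R^d$ followed by that of $V$ as orthonormal basis, let $\bar{\mathbf x}(\mathbf s)=(\mathbf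 s,\mathbf x(\mathbf s))$, and let $W\subset\mathcal O_{d,d+n}$ consist of the index $U$ with $e^U=e_{u,1}\wedge\dots\wedge e_{u,d}$ ($e_{u,j}$ the standard basis of $\mathbb R^d$) and of all the indices of the $e^P$ with $P\in\mathcal O_{d,n}$. Let $\mathcal H$ be the graded Hilbert space of all $\mathbf r=(\mathbf r_m)_{m\ge 0}$ with $\mathbf r_m=(\mathbf r_m^\pi)_\pi\in\prod_{\pi\in\Sigma_m^d}(\Lambda^d\overline V_d)^{\otimes m}$ for $m\ge1$, $\mathbf r_0\in\mathbb R$ and $\sum_m\|\mathbf r_m\|^2<\infty$. The parametrized mapping space signature $\overline\Phi:\mathrm{Lip}_J(\square^d,V)\to\mathcal H$ is given by $\overline\Phi_0=1$ and, for $m\ge 1$, by the coordinates $$\overline\Phi_m^{\mathbf P,\pi}(\mathbf x)=\int_{\Delta^m_{\pi_1}\times\dots\times\Delta^m_{\pi_d}}\prod_{i=1}^mJ[\bar{\mathbf x}_{P_i}](\mathbf t_i)\,d\mathbf t\quad(\mathbf P\in W^m,\ \pi\in\Sigma_m^d),$$ where $\mathbf t_i=(t_{i,1},\dots,t_{i,d})$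 and $(t_{i,j})_i$ ranges over $\Delta^m_{\pi_j}=\{0\le t_{\pi_j(1)}<\dots<t_{\pi_j(m)}\le1\}$; the coordinates with $\mathbf P\in\mathcal O_{d,d+n}^m\setminus W^m$ are $0$. Let $\mathcal H_1=\{\mathbf r\in\mathcal H:\mathbf r_0=1\}$, and let $N:\mathcal H_1\to\mathcal H$ be a graded normalization, that is, a continuous injective map with $\sup\|N\|<\infty$ for which there is a function $\lambda:\mathcal H_1\to(0,\infty)$ with $N(\mathbf r)_m=\lambda(\mathbf r)^m\mathbf r_m$ for all $m$. Then $N\circ\overline\Phi:(\mathrm{Lip}_J(\square^d,V),\mu_\infty)\to\mathcal H$ 1. is continuous, injective and decays factorially: for each $\mathbf x$ there is $C>0$ such that for all $m$ and all $\pi\in\Sigma_m^d$ $$\|(N\circ\overline\Phi)_m^\pi(\mathbf x)\|\le\frac{C^m}{(m!)^d}\quad\text{and}\quad\|(N\circ\overline\Phi)_m(\mathbf x)\|^2\le\frac{C^m}{(m!)^d};$$ 2. is universal to $C_b(\mathrm{Lip}_J(\square^d,V),\mathbb R)$ with the strict topology: every function $\langle\ell,N\circ\overline\Phi(\cdot)\rangle$,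 $\ell\in\mathcal H$, is bounded and continuous, and these functions are dense in the topology generated by the seminorms $p_\psi(f)=\sup_x|f(x)\psi(x)|$, where $\psi$ ranges over the bounded real functions that vanish at infinity (for every $\epsilon>0$ one has $|\psi|<\epsilon$ outside some compact set); 3. is characteristic to the finite regular (signed) Borel measures on $\mathrm{Lip}_J(\square^d,V)$: it is integrable against each of them, and $\mu\mapsto\int N\circ\overline\Phi\,d\mu\in\mathcal H$ is injective on them. Regularity means that the total variation $|\mu|$ is outer regular with respect to open sets and inner regular with respect to compact sets. -/

import Mathlib

open Set MeasureTheory Topology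
open scoped ENNReal NNReal BoundedContinuousFunction

noncomputable section

namespace MapSig

/-! ### Lipschitz maps on the cube -/

/-- The unit cube `[0,1]^d`. It carries the (sup) metric induced by `Fin d → ℝ`; as all norms on
`ℝ^d` are equivalent, this gives the usual notion of a Lipschitz map. -/
abbrev Cube (d : ℕ) : Type := ↥(Icc (0 : Fin d → ℝ) 1)

/-- `Lip([0,1]^d, V)`. -/
abbrev LipMap (d : ℕ) (V : Type*) [PseudoEMetricSpace V] : Type _ :=
  {x : Cube d → V // ∃ K : ℝ≥0, LipschitzWith K x}

/-- The coordinatewise retraction of `ℝ^d` onto the cube. -/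
def clamp {d : ℕ} (s : Fin d → ℝ) : Cube d :=
  ⟨fun i => (projIcc (0 : ℝ) 1 zero_le_one (s i) : ℝ),
    fun i => (projIcc (0 : ℝ) 1 zero_le_one (s i)).2.1,
    fun i => (projIcc (0 : ℝ) 1 zero_le_one (s i)).2.2⟩

/-- The extension of a map on the cube to `ℝ^d` that is constant along the retraction. On the
interior of the cube it has the same derivatives as the map itself. -/
def LipMap.ext {d : ℕ} {V : Type*} [PseudoEMetricSpace V] (x : LipMap d V) (s : Fin d → ℝ) : V :=
  x.1 (clamp s)

/-! ### Jacobian minors -/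

/-- `𝒪_{d,n}`: order-preserving injections `[d] → [n]`. -/
abbrev OrdInj (d n : ℕ) : Type := Fin d ↪o Fin n

section Jacobian

variable {d n : ℕ} {V : Type*} [NormedAddCommGroup V] [InnerProductSpace ℝ V]

/-- The partial derivative `∂x_k/∂s_j` of the `k`-th coordinate of `x` in the orthonormal
basis `b`. -/
def pderiv (b : OrthonormalBasis (Fin n) ℝ V) (x : LipMap d V) (k : Fin n) (j : Fin d)
    (s : Fin d → ℝ) : ℝ :=
  fderiv ℝ (fun u => b.repr (x.ext u) k) s (Pi.single j 1)

/-- The Jacobian minor `J[x_P]`: the determinant of the partial derivatives of the coordinates of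
`x` selected by `P`. -/
def minor (b : OrthonormalBasis (Fin n) ℝ V) (x : LipMap d V) (P : OrdInj d n)
    (s : Fin d → ℝ) : ℝ :=
  (Matrix.of fun i j : Fin d => pderiv b x (P i) j s).det

/-- The Jacobian minor operator at a point, an element of `Λ^d V` written in the orthonormal basis
`e^P = e_{P(1)} ∧ ⋯ ∧ e_{P(d)}`, `P ∈ 𝒪_{d,n}`. -/
def jacobianAt (b : OrthonormalBasis (Fin n) ℝ V) (x : LipMap d V) (s : Fin d → ℝ) :
    EuclideanSpace ℝ (OrdInj d n) :=
  WithLp.toLp 2 fun P => minor b x P s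

theorem lipschitz_clamp : LipschitzWith 1 (clamp (d := d)) := by
  refine LipschitzWith.of_dist_le_mul fun s t => ?_
  rw [Subtype.dist_eq, NNReal.coe_one, one_mul]
  refine (dist_pi_le_iff dist_nonneg).2 fun i => ?_
  have h := (LipschitzWith.projIcc (zero_le_one (α := ℝ))).dist_le_mul (s i) (t i)
  rw [NNReal.coe_one, one_mul] at h
  exact h.trans (dist_le_pi_dist s t i)

theorem exists_abs_minor_le (b : OrthonormalBasis (Fin n) ℝ V) (x : LipMap d V) :
    ∃ B : ℝ, 0 ≤ B ∧ ∀ P s, |minor b x P s| ≤ B := by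
  obtain ⟨K, hK⟩ := x.2
  refine ⟨(Fintype.card (Fin d)).factorial • (K : ℝ) ^ Fintype.card (Fin d), by positivity,
    fun P s => ?_⟩
  refine Matrix.det_le (abv := AbsoluteValue.abs) fun i j => ?_
  have hext : LipschitzWith K (fun u => b.repr (x.ext u) (P i)) := by
    refine LipschitzWith.of_dist_le_mul fun u v => ?_
    have h1 : dist (x.ext u) (x.ext v) ≤ K * dist u v := by
      have h2 := (hK.comp (lipschitz_clamp (d := d))).dist_le_mul u v
      simpa [LipMap.ext] using h2
    refine le_trans ?_ h1
    rw [← b.repr.dist_map, dist_eq_norm, dist_eq_norm]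
    exact PiLp.norm_apply_le (b.repr (x.ext u) - b.repr (x.ext v)) (P i)
  have h3 := (fderiv ℝ (fun u => b.repr (x.ext u) (P i)) s).le_opNorm
    (Pi.single j (1 : ℝ) : Fin d → ℝ)
  have h4 : ‖(Pi.single j (1 : ℝ) : Fin d → ℝ)‖ = 1 := by
    rw [Pi.norm_single, norm_one]
  rw [h4, mul_one] at h3
  exact h3.trans (norm_fderiv_le_of_lipschitz ℝ hext)

theorem measurable_minor (b : OrthonormalBasis (Fin n) ℝ V) (x : LipMap d V) (P : OrdInj d n) :
    Measurable (minor b x P) := by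
  have h : minor b x P = fun s => ∑ σ : Equiv.Perm (Fin d), Equiv.Perm.sign σ •
      ∏ i, pderiv b x (P (σ i)) i s := by
    funext s
    simp [minor, Matrix.det_apply]
  rw [h]
  refine Finset.measurable_fun_sum _ fun σ _ => ?_
  refine Measurable.const_smul (Finset.measurable_fun_prod _ fun i _ => ?_) _
  exact measurable_fderiv_apply_const ℝ _ _

theorem memLp_jacobianAt (b : OrthonormalBasis (Fin n) ℝ V) (x : LipMap d V) :
    MemLp (jacobianAt b x) ∞ (volume.restrict (Icc (0 : Fin d → ℝ) 1)) := by
  obtain ⟨B, hB0, hB⟩ := exists_abs_minor_le b x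
  have hm : Measurable (jacobianAt b x) :=
    (WithLp.measurable_toLp 2 _).comp (measurable_pi_lambda _ fun P => measurable_minor b x P)
  refine memLp_top_of_bound hm.aestronglyMeasurable
    (Real.sqrt (∑ _P : OrdInj d n, B ^ 2)) (Filter.Eventually.of_forall fun s => ?_)
  rw [EuclideanSpace.norm_eq]
  refine Real.sqrt_le_sqrt (Finset.sum_le_sum fun P _ => ?_)
  exact pow_le_pow_left₀ (norm_nonneg _) (hB P s) 2

/-- The Jacobian minor operator `d̂ : Lip([0,1]^d, V) → L^∞([0,1]^d, Λ^d V)`. -/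
def jacobianMinor (b : OrthonormalBasis (Fin n) ℝ V) (x : LipMap d V) :
    Lp (EuclideanSpace ℝ (OrdInj d n)) ∞ (volume.restrict (Icc (0 : Fin d → ℝ) 1)) :=
  (memLp_jacobianAt b x).toLp _

/-- Jacobian equivalence: `x ∼ y` iff `d̂x = d̂y` in `L^∞`. -/
def jacobianSetoid (d : ℕ) (b : OrthonormalBasis (Fin n) ℝ V) : Setoid (LipMap d V) :=
  Setoid.ker (jacobianMinor b)

/-- `Lip_J([0,1]^d, V)`: Jacobian equivalence classes of Lipschitz maps. -/
def LipJ (d : ℕ) (b : OrthonormalBasis (Fin n) ℝ V) : Type _ := Quotient (jacobianSetoid d b)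

/-- The Jacobian minor operator on equivalence classes. -/
def LipJ.jac {b : OrthonormalBasis (Fin n) ℝ V} (x : LipJ d b) :
    Lp (EuclideanSpace ℝ (OrdInj d n)) ∞ (volume.restrict (Icc (0 : Fin d → ℝ) 1)) :=
  Quotient.lift (jacobianMinor b) (fun _ _ h => h) x

theorem LipJ.jac_injective {b : OrthonormalBasis (Fin n) ℝ V} :
    Function.Injective (LipJ.jac (d := d) (b := b)) := by
  rintro ⟨x⟩ ⟨y⟩ h
  exact Quotient.sound h

/-- The Jacobian Lipschitz metric `μ_∞(x, y) = ‖d̂x - d̂y‖_∞`. -/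
instance (b : OrthonormalBasis (Fin n) ℝ V) : MetricSpace (LipJ d b) :=
  MetricSpace.induced LipJ.jac LipJ.jac_injective inferInstance

instance (b : OrthonormalBasis (Fin n) ℝ V) : MeasurableSpace (LipJ d b) := borel _

instance (b : OrthonormalBasis (Fin n) ℝ V) : BorelSpace (LipJ d b) := ⟨rfl⟩

end Jacobian

/-! ### The permutation tensor Hilbert space -/

/-- The level `m` permutation tensor space `∏_{π ∈ Σ_m^d} (Λ^d E)^{⊗ m}` for `dim E = N`, with
`(Λ^d E)^{⊗ m}` written in its orthonormal basis `e^{P_1} ⊗ ⋯ ⊗ e^{P_m}`, `P_i ∈ 𝒪_{d,N}`. -/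
abbrev PermTensor (d N m : ℕ) : Type :=
  PiLp 2 fun _ : Fin d → Equiv.Perm (Fin m) => EuclideanSpace ℝ (Fin m → OrdInj d N)

/-- The power series permutation tensor Hilbert space: sequences `(r_m)_m`, `r_m` of level `m`,
with `∑ ‖r_m‖² < ∞`. -/
abbrev PermHilbert (d N : ℕ) : Type := ↥(lp (fun m : ℕ => PermTensor d N m) 2)

/-- The affine subspace of elements with `r_0 = 1` (level `0` is one-dimensional). -/
abbrev UnitPermHilbert (d N : ℕ) : Type :=
  {r : PermHilbert d N // ∀ π P, (r : ∀ m, PermTensor d N m) 0 π P = 1}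

/-- A graded normalization: a continuous injective map `r ↦ δ_{λ(r)} r` with bounded values, where
`δ_λ` multiplies level `m` by `λ ^ m` and `λ(r) > 0`. -/
structure IsGradedNormalization {d N : ℕ} (ν : UnitPermHilbert d N → PermHilbert d N) : Prop where
  continuous : Continuous ν
  injective : Function.Injective ν
  bounded : ∃ C : ℝ, 0 < C ∧ ∀ r, ‖ν r‖ ≤ C
  scaling : ∃ scale : UnitPermHilbert d N → ℝ, ∀ r, 0 < scale r ∧
    ∀ m, (ν r : ∀ m, PermTensor d N m) m =
      scale r ^ m • (r.1 : ∀ m, PermTensor d N m) m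

/-! ### The mapping space signature -/

/-- The permuted simplex `{0 ≤ t_{π(1)} < ⋯ < t_{π(m)} ≤ 1}`. -/
def permSimplex {m : ℕ} (π : Equiv.Perm (Fin m)) : Set (Fin m → ℝ) :=
  {t | StrictMono (fun i => t (π i)) ∧ ∀ i, t i ∈ Icc (0 : ℝ) 1}

/-- The integration domain `Δ^m_{π_1} × ⋯ × Δ^m_{π_d}`; the point `t_i ∈ [0,1]^d` is
`fun j => t j i`. -/
def sigDomain {d m : ℕ} (π : Fin d → Equiv.Perm (Fin m)) : Set (Fin d → Fin m → ℝ) :=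
  {t | ∀ j, t j ∈ permSimplex (π j)}

section Signature

variable {d n : ℕ} {V : Type*} [NormedAddCommGroup V] [InnerProductSpace ℝ V]

/-- The mapping space monomial `Φ_m^{P,π}(x)`. -/
def monomial (b : OrthonormalBasis (Fin n) ℝ V) (x : LipMap d V) {m : ℕ}
    (P : Fin m → OrdInj d n) (π : Fin d → Equiv.Perm (Fin m)) : ℝ :=
  ∫ t in sigDomain π, ∏ i, minor b x (P i) (fun j => t j i)

open Classical in
/-- Level `m` of the signature restricted to `W`: the coordinates with some `P_i ∉ W` are `0`. -/
def sigLevel (b : OrthonormalBasis (Fin n) ℝ V) (W : Set (OrdInj d n)) (x : LipMap d V) (m : ℕ) :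
    PermTensor d n m :=
  WithLp.toLp 2 fun π => WithLp.toLp 2 fun P =>
    if ∀ i, P i ∈ W then monomial b x P π else 0

theorem measurableSet_permSimplex {m : ℕ} (π : Equiv.Perm (Fin m)) :
    MeasurableSet (permSimplex π) := by
  have h : permSimplex π = (⋂ i, ⋂ j, ⋂ _ : i < j, {t : Fin m → ℝ | t (π i) < t (π j)}) ∩
      ⋂ i, {t : Fin m → ℝ | t i ∈ Icc (0 : ℝ) 1} := by
    ext t
    simp [permSimplex, StrictMono]
  rw [h]
  refine MeasurableSet.inter ?_ ?_
  · refine MeasurableSet.iInter fun i => MeasurableSet.iInter fun j => MeasurableSet.iInter fun _ =>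
      measurableSet_lt (measurable_pi_apply _) (measurable_pi_apply _)
  · exact MeasurableSet.iInter fun i => measurable_pi_apply i measurableSet_Icc

theorem volume_permSimplex_le {m : ℕ} (π : Equiv.Perm (Fin m)) :
    volume (permSimplex π) ≤ ((m.factorial : ℝ≥0∞))⁻¹ := by
  have hvol : ∀ σ : Equiv.Perm (Fin m), volume (permSimplex σ) = volume (permSimplex π) := by
    have key : ∀ σ : Equiv.Perm (Fin m),
        volume (permSimplex σ) = volume (permSimplex (1 : Equiv.Perm (Fin m))) := by
      intro σ
      have hp := volume_measurePreserving_piCongrLeft (fun _ : Fin m => ℝ) σ.symm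
      rw [← hp.measure_preimage (measurableSet_permSimplex 1).nullMeasurableSet]
      congr 1
      have happ : ∀ (t : Fin m → ℝ) (i : Fin m),
          MeasurableEquiv.piCongrLeft (fun _ : Fin m => ℝ) σ.symm t i = t (σ i) := by
        intro t i
        have := MeasurableEquiv.piCongrLeft_apply_apply (β := fun _ : Fin m => ℝ) σ.symm t (σ i)
        simpa using this
      ext t
      simp only [permSimplex, mem_ofPred_eq, mem_preimage, happ, Equiv.Perm.one_apply]
      exact and_congr_right fun _ => ⟨fun h i => h (σ i), fun h i => by simpa using h (σ.symm i)⟩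
    intro σ
    rw [key σ, key π]
  have hdisj : Pairwise (Function.onFun Disjoint fun σ : Equiv.Perm (Fin m) => permSimplex σ) := by
    intro σ τ hne
    refine Set.disjoint_left.2 fun t h1 h2 => hne ?_
    have hmono : StrictMono (fun i => (τ⁻¹ * σ) i) := by
      intro i j hij
      have h3 := h1.1 hij
      have h4 : (fun k => t (τ k)) ((τ⁻¹ * σ) i) < (fun k => t (τ k)) ((τ⁻¹ * σ) j) := by
        simpa using h3
      exact h2.1.lt_iff_lt.1 h4
    have h5 : ∀ i, (τ⁻¹ * σ) i = i := by
      intro i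
      have h6 := Subsingleton.elim
        (StrictMono.orderIsoOfSurjective _ hmono (τ⁻¹ * σ).surjective) (OrderIso.refl (Fin m))
      exact congrArg (fun f : Fin m ≃o Fin m => f i) h6
    have h7 : τ⁻¹ * σ = 1 := Equiv.ext h5
    exact (inv_mul_eq_one.1 h7).symm
  have hsum : (m.factorial : ℝ≥0∞) * volume (permSimplex π) ≤ 1 := by
    have h1 : volume (⋃ σ : Equiv.Perm (Fin m), permSimplex σ) =
        (m.factorial : ℝ≥0∞) * volume (permSimplex π) := by
      rw [measure_iUnion hdisj measurableSet_permSimplex, tsum_fintype,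
        Finset.sum_congr rfl fun σ _ => hvol σ]
      simp [Fintype.card_perm]
    rw [← h1]
    calc volume (⋃ σ : Equiv.Perm (Fin m), permSimplex σ)
        ≤ volume (Set.pi univ fun _ : Fin m => Icc (0 : ℝ) 1) :=
          measure_mono (iUnion_subset fun σ t ht i _ => ht.2 i)
      _ = 1 := by rw [volume_pi_pi]; simp
  rw [ENNReal.le_inv_iff_mul_le, mul_comm]
  exact hsum

theorem sigDomain_eq {m : ℕ} (π : Fin d → Equiv.Perm (Fin m)) :
    sigDomain π = Set.pi univ fun j => permSimplex (π j) := by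
  ext t
  simp [sigDomain]

theorem volume_sigDomain_le {m : ℕ} (π : Fin d → Equiv.Perm (Fin m)) :
    volume (sigDomain π) ≤ ((m.factorial : ℝ≥0∞))⁻¹ ^ d := by
  rw [sigDomain_eq, volume_pi_pi]
  refine (Finset.prod_le_prod' fun j _ => volume_permSimplex_le (π j)).trans ?_
  simp

theorem abs_monomial_le (b : OrthonormalBasis (Fin n) ℝ V) (x : LipMap d V) {B : ℝ} (hB0 : 0 ≤ B)
    (hB : ∀ P s, |minor b x P s| ≤ B) {m : ℕ} (P : Fin m → OrdInj d n)
    (π : Fin d → Equiv.Perm (Fin m)) :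
    |monomial b x P π| ≤ B ^ m * ((m.factorial : ℝ)⁻¹) ^ d := by
  have hv := volume_sigDomain_le π
  have hfin : ((m.factorial : ℝ≥0∞))⁻¹ ^ d ≠ ∞ :=
    ENNReal.pow_ne_top (ENNReal.inv_ne_top.2 (by exact_mod_cast m.factorial_ne_zero))
  have h1 : ‖monomial b x P π‖ ≤ B ^ m * volume.real (sigDomain π) := by
    refine norm_setIntegral_le_of_norm_le_const (hv.trans_lt hfin.lt_top) fun t _ => ?_
    rw [norm_prod]
    refine (Finset.prod_le_prod (fun _ _ => norm_nonneg _) fun i _ => hB (P i) _).trans ?_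
    simp
  refine h1.trans (mul_le_mul_of_nonneg_left ?_ (by positivity))
  have h2 := ENNReal.toReal_mono hfin hv
  simpa [Measure.real] using h2

theorem memℓp_sigLevel [NeZero d] (b : OrthonormalBasis (Fin n) ℝ V) (W : Set (OrdInj d n))
    (x : LipMap d V) : Memℓp (sigLevel b W x) 2 := by
  obtain ⟨B, hB0, hB⟩ := exists_abs_minor_le b x
  set c : ℝ := (Fintype.card (OrdInj d n) : ℝ) with hc
  have hbound : ∀ m, ‖sigLevel b W x m‖ ^ 2 ≤ (c * B ^ 2) ^ m / m.factorial := by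
    intro m
    have hf : (1 : ℝ) ≤ m.factorial := by exact_mod_cast m.factorial_pos
    have hcoord : ∀ π P, ‖sigLevel b W x m π P‖ ^ 2 ≤ (B ^ m * ((m.factorial : ℝ)⁻¹) ^ d) ^ 2 := by
      intro π P
      refine pow_le_pow_left₀ (norm_nonneg _) ?_ 2
      simp only [sigLevel]
      split_ifs
      · exact abs_monomial_le b x hB0 hB P π
      · rw [norm_zero]; positivity
    have h1 : ‖sigLevel b W x m‖ ^ 2 ≤
        ∑ _π : Fin d → Equiv.Perm (Fin m), ∑ _P : Fin m → OrdInj d n,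
          (B ^ m * ((m.factorial : ℝ)⁻¹) ^ d) ^ 2 := by
      rw [PiLp.norm_sq_eq_of_L2]
      refine Finset.sum_le_sum fun π _ => ?_
      rw [EuclideanSpace.norm_sq_eq]
      exact Finset.sum_le_sum fun P _ => hcoord π P
    refine h1.trans ?_
    have h2 : ∑ _π : Fin d → Equiv.Perm (Fin m), ∑ _P : Fin m → OrdInj d n,
          (B ^ m * ((m.factorial : ℝ)⁻¹) ^ d) ^ 2 = (c * B ^ 2) ^ m / (m.factorial : ℝ) ^ d := by
      simp only [Finset.sum_const, Finset.card_univ, Fintype.card_pi, Finset.prod_const,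
        Fintype.card_perm, Fintype.card_fin, nsmul_eq_mul, Nat.cast_pow, ← hc]
      have : (m.factorial : ℝ) ≠ 0 := by positivity
      rw [inv_pow, mul_pow c]
      field_simp
      ring
    rw [h2]
    have hcB : 0 ≤ (c * B ^ 2) ^ m := by positivity
    refine div_le_div_of_nonneg_left hcB (by positivity) ?_
    exact le_self_pow₀ hf (NeZero.ne d)
  refine memℓp_gen ?_
  refine Summable.of_nonneg_of_le (fun m => by positivity) (fun m => ?_)
    (Real.summable_pow_div_factorial (c * B ^ 2))
  simpa using hbound m

/-- The mapping space signature restricted to `W`, in coordinates. -/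
def signature [NeZero d] (b : OrthonormalBasis (Fin n) ℝ V) (W : Set (OrdInj d n))
    (x : LipMap d V) : PermHilbert d n :=
  ⟨sigLevel b W x, memℓp_sigLevel b W x⟩

/-! ### The parametrized signature -/

/-- The augmented space `ℝ^d × V` with the product inner product. -/
abbrev Aug (d : ℕ) (V : Type*) : Type _ := WithLp 2 (EuclideanSpace ℝ (Fin d) × V)

/-- The orthonormal basis `e_{u,1}, …, e_{u,d}, e_{v,1}, …, e_{v,n}` of the augmented space. -/
def augBasis (d : ℕ) (b : OrthonormalBasis (Fin n) ℝ V) :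
    OrthonormalBasis (Fin (d + n)) ℝ (Aug d V) :=
  ((EuclideanSpace.basisFun (Fin d) ℝ).prod b).reindex finSumFinEquiv

/-- The inclusion `ι(x)(s) = (s, x(s))`. -/
def augment (x : LipMap d V) : LipMap d (Aug d V) :=
  ⟨fun s => WithLp.toLp 2 (WithLp.toLp 2 (s : Fin d → ℝ), x.1 s), by
    obtain ⟨K, hK⟩ := x.2
    have h1 : LipschitzWith _ fun s : Cube d =>
        (WithLp.toLp 2 (s : Fin d → ℝ) : EuclideanSpace ℝ (Fin d)) :=
      (PiLp.lipschitzWith_toLp 2 fun _ : Fin d => ℝ).comp (LipschitzWith.subtype_val _)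
    exact ⟨_, (WithLp.prod_lipschitzWith_toLp 2 (EuclideanSpace ℝ (Fin d)) V).comp
      (h1.prodMk hK)⟩⟩

/-- The index `U`, with `e^U = e_{u,1} ∧ ⋯ ∧ e_{u,d}`. -/
def paramIndex (d n : ℕ) : OrdInj d (d + n) := Fin.castAddOrderEmb n

/-- The inclusion `𝒪_{d,n} ⊂ 𝒪_{d,d+n}`, with `P` going to `e_{v,P(1)} ∧ ⋯ ∧ e_{v,P(d)}`. -/
def shiftIndex {d n : ℕ} (P : OrdInj d n) : OrdInj d (d + n) := P.trans (Fin.natAddOrderEmb d)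

/-- `W = {U} ∪ 𝒪_{d,n} ⊂ 𝒪_{d,d+n}`. -/
def paramW (d n : ℕ) : Set (OrdInj d (d + n)) := {paramIndex d n} ∪ range shiftIndex

theorem repr_augment_castAdd (b : OrthonormalBasis (Fin n) ℝ V) (x : LipMap d V)
    (u : Fin d → ℝ) (i : Fin d) :
    (augBasis d b).repr ((augment x).ext u) (Fin.castAdd n i) =
      (clamp u : Fin d → ℝ) i := by
  rw [OrthonormalBasis.repr_apply_apply]
  simp [augBasis, augment, LipMap.ext, WithLp.prod_inner_apply, EuclideanSpace.inner_single_left]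

theorem repr_augment_natAdd (b : OrthonormalBasis (Fin n) ℝ V) (x : LipMap d V)
    (u : Fin d → ℝ) (k : Fin n) :
    (augBasis d b).repr ((augment x).ext u) (Fin.natAdd d k) = b.repr (x.ext u) k := by
  rw [OrthonormalBasis.repr_apply_apply, OrthonormalBasis.repr_apply_apply]
  simp [augBasis, augment, LipMap.ext, WithLp.prod_inner_apply]

theorem minor_paramIndex (b : OrthonormalBasis (Fin n) ℝ V) (x y : LipMap d V) :
    minor (augBasis d b) (augment x) (paramIndex d n) =
      minor (augBasis d b) (augment y) (paramIndex d n) := by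
  funext s
  simp [minor, pderiv, paramIndex, repr_augment_castAdd]

theorem minor_shiftIndex (b : OrthonormalBasis (Fin n) ℝ V) (x : LipMap d V) (P : OrdInj d n) :
    minor (augBasis d b) (augment x) (shiftIndex P) = minor b x P := by
  funext s
  simp [minor, pderiv, shiftIndex, repr_augment_natAdd]

theorem signature_augment_congr [NeZero d] (b : OrthonormalBasis (Fin n) ℝ V) (x y : LipMap d V)
    (h : jacobianMinor b x = jacobianMinor b y) :
    signature (augBasis d b) (paramW d n) (augment x) =
      signature (augBasis d b) (paramW d n) (augment y) := by
  have hae : ∀ᵐ s : Fin d → ℝ, s ∈ Icc (0 : Fin d → ℝ) 1 → ∀ P, minor b x P s = minor b y P s := by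
    have h1 := (MemLp.toLp_eq_toLp_iff (memLp_jacobianAt b x) (memLp_jacobianAt b y)).1 h
    filter_upwards [(ae_restrict_iff' measurableSet_Icc).1 h1] with s hs hmem P
    exact congrArg (fun v : EuclideanSpace ℝ (OrdInj d n) => v P) (hs hmem)
  have hW : ∀ᵐ s : Fin d → ℝ, s ∈ Icc (0 : Fin d → ℝ) 1 → ∀ P ∈ paramW d n,
      minor (augBasis d b) (augment x) P s = minor (augBasis d b) (augment y) P s := by
    filter_upwards [hae] with s hs hmem P hP
    rcases hP with hP | ⟨Q, rfl⟩
    · rw [mem_singleton_iff.1 hP, minor_paramIndex b x y]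
    · rw [minor_shiftIndex, minor_shiftIndex]
      exact hs hmem Q
  refine Subtype.ext (funext fun m => ?_)
  refine congrArg (WithLp.toLp 2) (funext fun π => congrArg (WithLp.toLp 2) (funext fun P => ?_))
  split_ifs with hP
  · have hD : MeasurableSet (sigDomain π) := by
      rw [sigDomain_eq]
      exact MeasurableSet.univ_pi fun j => measurableSet_permSimplex (π j)
    refine setIntegral_congr_ae hD ?_
    have hcube : Set.pi univ (fun _ : Fin d => Icc (0 : ℝ) 1) = Icc (0 : Fin d → ℝ) 1 :=
      Set.pi_univ_Icc 0 1
    have hmp : ∀ i : Fin m, MeasurePreserving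
        (fun (t : Fin d → Fin m → ℝ) (j : Fin d) => t j i)
        (volume.restrict (Set.pi univ fun _ => Set.pi univ fun _ => Icc (0 : ℝ) 1))
        (volume.restrict (Icc (0 : Fin d → ℝ) 1)) := by
      intro i
      have hprob : IsProbabilityMeasure (volume.restrict (Icc (0 : ℝ) 1)) := ⟨by simp⟩
      rw [← hcube, volume_pi, volume_pi, Measure.restrict_pi_pi, Measure.restrict_pi_pi, volume_pi,
        Measure.restrict_pi_pi]
      exact measurePreserving_pi _ _ fun _ => measurePreserving_eval _ i
    have hall : ∀ᵐ t : Fin d → Fin m → ℝ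
        ∂volume.restrict (Set.pi univ fun _ => Set.pi univ fun _ => Icc (0 : ℝ) 1),
        ∀ i : Fin m, ∀ Q ∈ paramW d n,
          minor (augBasis d b) (augment x) Q (fun j => t j i) =
            minor (augBasis d b) (augment y) Q (fun j => t j i) :=
      ae_all_iff.2 fun i => (hmp i).quasiMeasurePreserving.ae
        ((ae_restrict_iff' measurableSet_Icc).2 hW)
    have hbig : MeasurableSet (Set.pi univ fun _ : Fin d =>
        Set.pi univ fun _ : Fin m => Icc (0 : ℝ) 1) :=
      MeasurableSet.univ_pi fun _ => MeasurableSet.univ_pi fun _ => measurableSet_Icc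
    filter_upwards [(ae_restrict_iff' hbig).1 hall] with t ht hmem
    exact Finset.prod_congr rfl fun i _ => ht (fun j _ k _ => (hmem j).2 k) i (P i) (hP i)
  · rfl

theorem signature_zero [NeZero d] (b : OrthonormalBasis (Fin n) ℝ V) (W : Set (OrdInj d n))
    (x : LipMap d V) (π : Fin d → Equiv.Perm (Fin 0)) (P : Fin 0 → OrdInj d n) :
    (signature b W x : ∀ m, PermTensor d n m) 0 π P = 1 := by
  have h1 : sigDomain π = univ := by
    refine eq_univ_of_forall fun t j => ⟨fun i => i.elim0, fun i => i.elim0⟩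
  have h2 : volume (univ : Set (Fin d → Fin 0 → ℝ)) = 1 := by
    have h3 : volume (univ : Set (Fin 0 → ℝ)) = 1 := by
      rw [← Set.pi_univ univ, volume_pi_pi]
      simp
    rw [← Set.pi_univ univ, volume_pi_pi]
    simp only [h3, Finset.prod_const_one]
  simp [signature, sigLevel, monomial, h1, h2, Measure.real]

/-- The parametrized mapping space signature, the signature of `ι(x)` restricted to `W`, as a map
on Jacobian equivalence classes; its level `0` component is `1`. -/
def paramSignature [NeZero d] (b : OrthonormalBasis (Fin n) ℝ V) (x : LipJ d b) :
    UnitPermHilbert d (d + n) :=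
  Quotient.lift
    (fun x : LipMap d V => (⟨signature (augBasis d b) (paramW d n) (augment x),
      signature_zero (augBasis d b) (paramW d n) (augment x)⟩ : UnitPermHilbert d (d + n)))
    (fun x y h => Subtype.ext (signature_augment_congr b x y h)) x

end Signature

/-! ### The strict topology, universal and characteristic maps -/

section Strict

variable {X : Type*} [TopologicalSpace X]

/-- `B_0(X)`: bounded functions `ψ : X → ℝ`, not necessarily continuous, that vanish at
infinity. -/
def VanishingFun (X : Type*) [TopologicalSpace X] : Type _ :=
  {ψ : X → ℝ // (∃ M, ∀ x, |ψ x| ≤ M) ∧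
    ∀ ε : ℝ, 0 < ε → ∃ K : Set X, IsCompact K ∧ ∀ x, x ∉ K → |ψ x| < ε}

theorem bddAbove_strict (ψ : VanishingFun X) (f : X →ᵇ ℝ) :
    BddAbove (range fun x => |f x * ψ.1 x|) := by
  obtain ⟨M, hM⟩ := ψ.2.1
  refine ⟨‖f‖ * M, ?_⟩
  rintro _ ⟨x, rfl⟩
  simp only [abs_mul]
  exact mul_le_mul (f.norm_coe_le_norm x) (hM x) (abs_nonneg _) (norm_nonneg _)

/-- The seminorm `p_ψ(f) = sup_x |f(x) ψ(x)|` on `C_b(X, ℝ)`. -/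
def strictSeminorm (ψ : VanishingFun X) : Seminorm ℝ (X →ᵇ ℝ) :=
  Seminorm.of (fun f => ⨆ x, |f x * ψ.1 x|)
    (fun f g => by
      refine Real.iSup_le (fun x => ?_)
        (add_nonneg (Real.iSup_nonneg fun _ => abs_nonneg _) (Real.iSup_nonneg fun _ => abs_nonneg _))
      rw [BoundedContinuousFunction.add_apply, add_mul]
      exact (abs_add_le _ _).trans
        (add_le_add (le_ciSup (bddAbove_strict ψ f) x) (le_ciSup (bddAbove_strict ψ g) x)))
    (fun a f => by
      rw [Real.norm_eq_abs, Real.mul_iSup_of_nonneg (abs_nonneg a)]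
      congr 1
      funext x
      rw [BoundedContinuousFunction.smul_apply, smul_eq_mul, mul_assoc, abs_mul])

/-- The strict topology on `C_b(X, ℝ)`: the topology generated by the seminorms `p_ψ`. -/
abbrev strictTopology (X : Type*) [TopologicalSpace X] : TopologicalSpace (X →ᵇ ℝ) :=
  SeminormFamily.moduleFilterBasis
    (fun ψ : VanishingFun X => strictSeminorm ψ) |>.topology

variable {H : Type*} [NormedAddCommGroup H] [InnerProductSpace ℝ H]

/-- `Φ` is universal to `C_b(X, ℝ)` with the strict topology: every `⟨ℓ, Φ(·)⟩`, `ℓ ∈ H`, is a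
bounded continuous function, and these functions are dense. -/
def IsUniversal (Φ : X → H) : Prop :=
  (∀ ℓ : H, ∃ f : X →ᵇ ℝ, ∀ x, f x = inner ℝ ℓ (Φ x)) ∧
    @Dense (X →ᵇ ℝ) (strictTopology X) {f | ∃ ℓ : H, ∀ x, f x = inner ℝ ℓ (Φ x)}

/-- `Φ` is characteristic to the space of finite (signed) regular Borel measures: it is integrable
against every such measure `μ`, and `μ ↦ ∫ Φ dμ` is injective. `Regular` includes inner regularity
of open sets, hence, the total variation being finite, of all Borel sets, by compact sets. -/
def IsCharacteristic [CompleteSpace H] [MeasurableSpace X] [BorelSpace X] (Φ : X → H) : Prop :=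
  (∀ μ : SignedMeasure X, μ.variation.Regular → VectorMeasure.Integrable μ Φ) ∧
    InjOn (fun μ : SignedMeasure X => ∫ᵛ x, Φ x ∂<•μ) {μ | μ.variation.Regular}

end Strict

end MapSig

end

/-! The theorem reduces to one fact: the finite linear combinations of coordinates of the normalized
signature form a unital subalgebra of `C_b` that separates the points of `LipJ d b`
(`coordAlgebra`).

It is an algebra because a product of integrals over two products of simplices is an integral over
the set of longer tuples whose first and last blocks are ordered. Up to the null set of tuples with
ties, this set is a disjoint union of products of simplices (`monomial_mul_monomial`). Since `λ^m *
λ^k = λ^(m+k)`, a graded normalization preserves this relation; its boundedness puts the coordinates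
in `C_b`.

It separates points because the normalization and the signature are both injective. For the
signature, take words with one letter `P` and all others `U`. The `U`-minor is 1 almost everywhere,
so integrating out the other points over a suitable union of simplices leaves a moment `∫ J[x_P] ∏
s_j^{k_j}` (`setIntegral_momentSet`), and the moments determine `J[x_P]` (`ae_eq_zero_of_moments`).

Universality is then the Stone-Weierstrass theorem for the strict topology. For characteristicness,
finite regular measures are tight, so two of them that agree on the algebra agree on `C_b`
(`integral_eq_of_subalgebra`). Continuity and decay come from the volume bound `(m!)^(-d)` for the
domains and from a telescoping estimate for products of minors. -/

noncomputable section

namespace MapSig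

/-! ### Stone-Weierstrass for the strict topology -/

section StoneWeierstrass

variable {X : Type*} [TopologicalSpace X]

/-- Stone-Weierstrass on `K` says nothing about the approximant `a` off `K`. Composing `a` with a
polynomial close to the truncation at height `‖f‖` keeps it in the algebra and bounds it globally.
The truncation is 1-Lipschitz and fixes the values of `f`, so closeness on `K` survives. -/
theorem exists_mem_subalgebra_bounded_near (A : Subalgebra ℝ (X →ᵇ ℝ))
    (hA : ∀ x y, x ≠ y → ∃ g ∈ A, g x ≠ g y) (f : X →ᵇ ℝ) {K : Set X} (hK : IsCompact K) {η : ℝ}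
    (hη : 0 < η) :
    ∃ g ∈ A, (∀ x, |g x| ≤ ‖f‖ + η) ∧ ∀ x ∈ K, |g x - f x| < η := by
  have hsep : (A.map (BoundedContinuousFunction.toContinuousMapₐ ℝ)).SeparatesPoints := by
    intro x y hxy
    obtain ⟨g, hg, hne⟩ := hA x y hxy
    exact ⟨g, ⟨BoundedContinuousFunction.toContinuousMapₐ ℝ g, ⟨g, hg, rfl⟩, rfl⟩, hne⟩
  obtain ⟨_, ⟨a, ha, rfl⟩, hnear⟩ :=
    ContinuousMap.exists_mem_subalgebra_near_continuous_of_isCompact_of_separatesPoints hsep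
      f.toContinuousMap hK (half_pos hη)
  set T : ℝ → ℝ := fun t => max (-‖f‖) (min ‖f‖ t) with hT
  obtain ⟨p, hp⟩ := exists_polynomial_near_of_continuousOn (-‖a‖) ‖a‖ T
    (by rw [hT]; fun_prop) (η / 2) (half_pos hη)
  have heval : ∀ x, (Polynomial.aeval a p : X →ᵇ ℝ) x = p.eval (a x) := by
    intro x
    clear hp
    induction p using Polynomial.induction_on' with
    | add p q hp hq => simp [hp, hq]
    | monomial k c => simp [Polynomial.aeval_monomial]
  have hax : ∀ x, a x ∈ Icc (-‖a‖) ‖a‖ := fun x => abs_le.1 (a.norm_coe_le_norm x)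
  have hTb : ∀ t, |T t| ≤ ‖f‖ := fun t =>
    abs_le.2 ⟨le_max_left _ _, max_le (by linarith [norm_nonneg f]) (min_le_left _ _)⟩
  refine ⟨Polynomial.aeval a p, ?_, fun x => ?_, fun x hx => ?_⟩
  · exact Algebra.adjoin_le (singleton_subset_iff.2 ha) (Polynomial.aeval_mem_adjoin_singleton ℝ a)
  · rw [heval]
    have h1 := hp _ (hax x)
    have h2 := hTb (a x)
    have h3 := abs_sub_abs_le_abs_sub (p.eval (a x)) (T (a x))
    linarith
  · rw [heval]
    have h1 := hp _ (hax x)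
    have h2 : |a x - f x| < η / 2 := hnear x hx
    have hfx := abs_le.1 (f.norm_coe_le_norm x)
    have h3 : T (f x) = f x := by
      simp only [hT]
      rw [min_eq_right hfx.2, max_eq_right hfx.1]
    have h4 : |T (a x) - T (f x)| ≤ |a x - f x| :=
      (abs_max_sub_max_le_max _ _ _ _).trans (max_le (by simp)
        ((abs_min_sub_min_le_max _ _ _ _).trans (by simp)))
    rw [h3] at h4
    have h5 := abs_sub_le (p.eval (a x)) (T (a x)) (f x)
    linarith

theorem strictSeminorm_apply (ψ : VanishingFun X) (f : X →ᵇ ℝ) :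
    strictSeminorm ψ f = ⨆ x, |f x * ψ.1 x| := rfl

/-- The Stone-Weierstrass theorem for the strict topology. -/
theorem dense_strictTopology_subalgebra (A : Subalgebra ℝ (X →ᵇ ℝ))
    (hA : ∀ x y, x ≠ y → ∃ g ∈ A, g x ≠ g y) :
    @Dense (X →ᵇ ℝ) (strictTopology X) A := by
  let _ : TopologicalSpace (X →ᵇ ℝ) := strictTopology X
  have hw : WithSeminorms (fun ψ : VanishingFun X => strictSeminorm ψ) := ⟨rfl⟩
  intro f
  rw [mem_closure_iff_nhds]
  intro U hU
  obtain ⟨s, r, hr, hball⟩ := (hw.mem_nhds_iff f U).1 hU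
  have hψ : ∃ M : ℝ, 0 < M ∧ ∀ ψ ∈ s, ∀ x, |ψ.1 x| ≤ M := by
    choose B hB using fun ψ : VanishingFun X => ψ.2.1
    refine ⟨1 + ∑ ψ ∈ s, |B ψ|, by positivity, fun ψ hψ x => ?_⟩
    have := Finset.single_le_sum (f := fun ψ => |B ψ|) (fun _ _ => abs_nonneg _) hψ
    have h1 := hB ψ x
    have h2 := le_abs_self (B ψ)
    linarith
  obtain ⟨M, hM, hMψ⟩ := hψ
  -- On the compact sets `|ψ| ≤ M` and the error is at most `r / 2 / M`. Off them the error is only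
  -- bounded by `2 * ‖f‖ + 1`, but there `|ψ| < δ`. Both products stay below `r / 2`, which leaves
  -- room for the strict inequality after taking a supremum.
  set η : ℝ := min 1 (r / 2 / M) with hη
  have hη0 : 0 < η := by positivity
  set δ : ℝ := r / 2 / (2 * ‖f‖ + 1) with hδ
  have hδ0 : 0 < δ := by positivity
  choose K hK hKψ using fun ψ : VanishingFun X => ψ.2.2 δ hδ0
  obtain ⟨g, hg, hgb, hgK⟩ := exists_mem_subalgebra_bounded_near A hA f
    (s.isCompact_biUnion fun ψ _ => hK ψ) hη0
  refine ⟨g, hball ?_, hg⟩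
  rw [Seminorm.mem_ball]
  refine Seminorm.finset_sup_apply_lt hr fun ψ hψ => ?_
  rw [strictSeminorm_apply]
  refine lt_of_le_of_lt (Real.iSup_le (a := r / 2) (fun x => ?_) (by positivity)) (by linarith)
  rw [abs_mul, BoundedContinuousFunction.sub_apply]
  by_cases hx : x ∈ K ψ
  · have h1 := hgK x (mem_biUnion hψ hx)
    calc |g x - f x| * |ψ.1 x| ≤ (r / 2 / M) * M :=
          mul_le_mul (h1.le.trans (min_le_right _ _)) (hMψ ψ hψ x) (abs_nonneg _) (by positivity)
      _ = r / 2 := by field_simp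
  · have h1 : |g x - f x| ≤ 2 * ‖f‖ + 1 := by
      have h2 := abs_sub (g x) (f x)
      have h3 : |f x| ≤ ‖f‖ := f.norm_coe_le_norm x
      have h4 := hgb x
      have h5 : η ≤ 1 := min_le_left _ _
      linarith
    calc |g x - f x| * |ψ.1 x| ≤ (2 * ‖f‖ + 1) * δ :=
          mul_le_mul h1 (hKψ ψ x hx).le (abs_nonneg _) (by positivity)
      _ = r / 2 := by rw [hδ]; field_simp

end StoneWeierstrass

/-! ### Tight measures and the two abstract criteria -/

section Measures

variable {X : Type*} [TopologicalSpace X] [MeasurableSpace X] [BorelSpace X]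

/-- Finite measures that are tight and agree on a point-separating subalgebra agree on all bounded
continuous functions. -/
theorem integral_eq_of_subalgebra (A : Subalgebra ℝ (X →ᵇ ℝ))
    (hA : ∀ x y, x ≠ y → ∃ g ∈ A, g x ≠ g y) [T2Space X] {μ ν : Measure X} [IsFiniteMeasure μ]
    [IsFiniteMeasure ν]
    (htight : ∀ ε : ℝ, 0 < ε → ∃ K : Set X, IsCompact K ∧ μ.real Kᶜ ≤ ε ∧ ν.real Kᶜ ≤ ε)
    (h : ∀ g ∈ A, ∫ x, g x ∂μ = ∫ x, g x ∂ν) (f : X →ᵇ ℝ) :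
    ∫ x, f x ∂μ = ∫ x, f x ∂ν := by
  -- Splitting over `K` and its complement: a small error on most of the mass, a bounded error on
  -- the rest.
  have key : ∀ (ρ : Measure X) [IsFiniteMeasure ρ] (g : X →ᵇ ℝ) (K : Set X) (η C ε : ℝ),
      IsCompact K → 0 ≤ η → 0 ≤ C → (∀ x, |g x - f x| ≤ C) → (∀ x ∈ K, |g x - f x| ≤ η) →
      ρ.real Kᶜ ≤ ε → |∫ x, g x ∂ρ - ∫ x, f x ∂ρ| ≤ η * ρ.real univ + C * ε := by
    intro ρ _ g K η C ε hK hη hC hC' hη' hε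
    have hKm := hK.isClosed.measurableSet
    have hη'' : ∀ x ∈ K, ‖g x - f x‖ ≤ η := hη'
    have hC'' : ∀ x, ‖g x - f x‖ ≤ C := hC'
    rw [← integral_sub (g.integrable ρ) (f.integrable ρ),
      ← integral_add_compl hKm (f := fun x => g x - f x) ((g.integrable ρ).sub (f.integrable ρ))]
    refine (abs_add_le _ _).trans (add_le_add ?_ ?_)
    · refine (norm_setIntegral_le_of_norm_le_const (measure_lt_top ρ K) hη'').trans ?_
      exact mul_le_mul_of_nonneg_left (measureReal_mono (subset_univ _)) hη
    · refine (norm_setIntegral_le_of_norm_le_const (measure_lt_top ρ Kᶜ) fun x _ => hC'' x).trans ?_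
      exact mul_le_mul_of_nonneg_left hε hC
  refine eq_of_abs_sub_le_all fun ε hε => ?_
  -- The two applications of `key` add up to exactly `η * c`.
  set c : ℝ := μ.real univ + ν.real univ + 2 * (2 * ‖f‖ + 1) with hc
  have hc0 : 0 < c := by positivity
  set η : ℝ := min 1 (ε / c) with hη
  have hη0 : 0 < η := by positivity
  obtain ⟨K, hK, hμK, hνK⟩ := htight η hη0
  obtain ⟨g, hg, hgb, hgK⟩ := exists_mem_subalgebra_bounded_near A hA f hK hη0
  have hC : ∀ x, |g x - f x| ≤ 2 * ‖f‖ + 1 := by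
    intro x
    have h2 := abs_sub (g x) (f x)
    have h3 : |f x| ≤ ‖f‖ := f.norm_coe_le_norm x
    have h4 := hgb x
    have h5 : η ≤ 1 := min_le_left _ _
    linarith
  have h1 := key μ g K η _ η hK hη0.le (by positivity) hC (fun x hx => (hgK x hx).le) hμK
  have h2 := key ν g K η _ η hK hη0.le (by positivity) hC (fun x hx => (hgK x hx).le) hνK
  rw [h g hg] at h1
  have h3 := abs_sub_le (∫ x, f x ∂μ) (∫ x, g x ∂ν) (∫ x, f x ∂ν)
  rw [abs_sub_comm (∫ x, f x ∂μ) (∫ x, g x ∂ν)] at h3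
  have h4 : η * c ≤ ε := by
    calc η * c ≤ ε / c * c := mul_le_mul_of_nonneg_right (min_le_right _ _) hc0.le
      _ = ε := by field_simp
  rw [hc] at h4
  linarith

theorem exists_isCompact_measureReal_compl_le {ρ : Measure X} [IsFiniteMeasure ρ] [T2Space X]
    (hρ : ρ.Regular) {ε : ℝ} (hε : 0 < ε) :
    ∃ K : Set X, IsCompact K ∧ ρ.real Kᶜ ≤ ε := by
  obtain ⟨K, -, hK, hlt⟩ := MeasurableSet.univ.exists_isCompact_sdiff_lt (μ := ρ)
    (measure_ne_top _ _) (ε := ENNReal.ofReal ε) (by simpa using hε)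
  refine ⟨K, hK, ?_⟩
  rw [compl_eq_univ_sdiff]
  exact ENNReal.toReal_le_of_le_ofReal hε.le hlt.le

/-- Separability of `X` or `H` is not assumed, so continuity alone does not give strong
measurability. Regularity concentrates `ρ` on a countable union of compact sets, and a continuous
map has separable image on each of them. -/
theorem aestronglyMeasurable_of_continuous_of_regular {ρ : Measure X} [IsFiniteMeasure ρ]
    [T2Space X] (hρ : ρ.Regular) {H : Type*} [TopologicalSpace H]
    [TopologicalSpace.PseudoMetrizableSpace H] {Φ : X → H} (hΦ : Continuous Φ)
    [TopologicalSpace.PseudoMetrizableSpace X] :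
    AEStronglyMeasurable Φ ρ := by
  choose K hK hKε using fun k : ℕ =>
    exists_isCompact_measureReal_compl_le hρ (ε := 1 / ((k : ℝ) + 1)) (by positivity)
  have hnull : ρ (⋃ k, K k)ᶜ = 0 := by
    rw [← measureReal_eq_zero_iff]
    refine le_antisymm (le_of_forall_pos_le_add fun ε hε => ?_) measureReal_nonneg
    obtain ⟨k, hk⟩ := exists_nat_one_div_lt hε
    rw [zero_add]
    exact (measureReal_mono (compl_subset_compl.2 (subset_iUnion K k))).trans
      ((hKε k).trans hk.le)
  have hres : ρ.restrict (⋃ k, K k) = ρ := Measure.restrict_eq_self_of_ae_mem hnull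
  rw [← hres, aestronglyMeasurable_iUnion_iff]
  exact fun k => hΦ.continuousOn.aestronglyMeasurable_of_isCompact (hK k)
    (hK k).isClosed.measurableSet

/-- With Jordan decompositions, equality of the integrals of `Φ` reads `∫ Φ d(μ⁺ + ν⁻) = ∫ Φ d(ν⁺ +
μ⁻)`. Both sides involve positive finite measures dominated by the sum of the two variations, hence
tight. They agree on `A`, therefore on all bounded continuous functions, therefore as Borel measures
on a metric space. -/
theorem isCharacteristic_of_subalgebra {X : Type*} [MetricSpace X] [MeasurableSpace X]
    [BorelSpace X] {H : Type*} [NormedAddCommGroup H] [InnerProductSpace ℝ H] [CompleteSpace H]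
    {Φ : X → H} (hΦ : Continuous Φ) (hb : ∃ C, ∀ x, ‖Φ x‖ ≤ C) (A : Subalgebra ℝ (X →ᵇ ℝ))
    (hA : ∀ x y, x ≠ y → ∃ g ∈ A, g x ≠ g y)
    (hAΦ : ∀ g ∈ A, ∃ ℓ : H, ∀ x, g x = inner ℝ ℓ (Φ x)) : IsCharacteristic Φ := by
  obtain ⟨C, hC⟩ := hb
  have hvar : ∀ μ : SignedMeasure X, μ.variation =
      μ.toJordanDecomposition.posPart + μ.toJordanDecomposition.negPart := fun μ => by
    rw [← SignedMeasure.totalVariation_eq_variation, SignedMeasure.totalVariation]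
  have hfin : ∀ μ : SignedMeasure X, IsFiniteMeasure μ.variation := fun μ => by
    rw [hvar]; infer_instance
  have hint : ∀ μ : SignedMeasure X, μ.variation.Regular → Integrable Φ μ.variation := by
    intro μ hμ
    have := hfin μ
    exact Integrable.of_bound (aestronglyMeasurable_of_continuous_of_regular hμ hΦ) C
      (Filter.Eventually.of_forall hC)
  refine ⟨hint, fun μ hμ ν hν h => ?_⟩
  have hparts : ∀ μ : SignedMeasure X, μ.variation.Regular →
      Integrable Φ μ.toJordanDecomposition.posPart ∧
      Integrable Φ μ.toJordanDecomposition.negPart := fun μ hμ => by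
    have := hint μ hμ
    rw [hvar] at this
    exact integrable_add_measure.1 this
  have hsplit : ∀ μ : SignedMeasure X, μ.variation.Regular →
      ∫ᵛ x, Φ x ∂<•μ = ∫ x, Φ x ∂μ.toJordanDecomposition.posPart -
        ∫ x, Φ x ∂μ.toJordanDecomposition.negPart := fun μ hμ => by
    conv_lhs => rw [← SignedMeasure.toSignedMeasure_toJordanDecomposition μ]
    rw [JordanDecomposition.toSignedMeasure, VectorMeasure.integral_sub_vectorMeasure,
      VectorMeasure.integral_toSignedMeasure, VectorMeasure.integral_toSignedMeasure]
    · rw [VectorMeasure.Integrable, Measure.variation_toSignedMeasure]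
      exact (hparts μ hμ).1
    · rw [VectorMeasure.Integrable, Measure.variation_toSignedMeasure]
      exact (hparts μ hμ).2
  simp only [hsplit μ hμ, hsplit ν hν] at h
  obtain ⟨hμp, hμn⟩ := hparts μ hμ
  obtain ⟨hνp, hνn⟩ := hparts ν hν
  have hle : ∀ (μ : SignedMeasure X) (s : Set X),
      μ.toJordanDecomposition.posPart.real s ≤ μ.variation.real s ∧
      μ.toJordanDecomposition.negPart.real s ≤ μ.variation.real s := fun μ s => by
    rw [hvar, measureReal_add_apply]
    exact ⟨le_add_of_nonneg_right measureReal_nonneg, le_add_of_nonneg_left measureReal_nonneg⟩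
  have heq : μ.toJordanDecomposition.posPart + ν.toJordanDecomposition.negPart =
      ν.toJordanDecomposition.posPart + μ.toJordanDecomposition.negPart := by
    refine ext_of_forall_integral_eq_of_IsFiniteMeasure fun f =>
      integral_eq_of_subalgebra A hA (fun ε hε => ?_) (fun g hg => ?_) f
    · have := hfin μ
      have := hfin ν
      obtain ⟨K, hK, hKε⟩ := exists_isCompact_measureReal_compl_le hμ (half_pos hε)
      obtain ⟨L, hL, hLε⟩ := exists_isCompact_measureReal_compl_le hν (half_pos hε)
      have h1 : μ.variation.real (K ∪ L)ᶜ ≤ ε / 2 :=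
        (measureReal_mono (compl_subset_compl.2 subset_union_left)).trans hKε
      have h2 : ν.variation.real (K ∪ L)ᶜ ≤ ε / 2 :=
        (measureReal_mono (compl_subset_compl.2 subset_union_right)).trans hLε
      refine ⟨K ∪ L, hK.union hL, ?_, ?_⟩
      · rw [measureReal_add_apply]
        linarith [(hle μ (K ∪ L)ᶜ).1, (hle ν (K ∪ L)ᶜ).2]
      · rw [measureReal_add_apply]
        linarith [(hle ν (K ∪ L)ᶜ).1, (hle μ (K ∪ L)ᶜ).2]
    · obtain ⟨ℓ, hℓ⟩ := hAΦ g hg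
      simp only [hℓ]
      rw [integral_inner (hμp.add_measure hνn), integral_inner (hνp.add_measure hμn),
        integral_add_measure hμp hνn, integral_add_measure hνp hμn]
      congr 1
      rw [sub_eq_sub_iff_add_eq_add] at h
      exact h
  rw [← SignedMeasure.toSignedMeasure_toJordanDecomposition μ,
    ← SignedMeasure.toSignedMeasure_toJordanDecomposition ν, JordanDecomposition.toSignedMeasure,
    JordanDecomposition.toSignedMeasure, sub_eq_sub_iff_add_eq_add, ← Measure.toSignedMeasure_add,
    ← Measure.toSignedMeasure_add]
  exact Measure.toSignedMeasure_congr heq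

theorem isUniversal_of_subalgebra {X : Type*} [TopologicalSpace X] {H : Type*}
    [NormedAddCommGroup H] [InnerProductSpace ℝ H] {Φ : X → H} (hΦ : Continuous Φ)
    (hb : ∃ C, ∀ x, ‖Φ x‖ ≤ C) (A : Subalgebra ℝ (X →ᵇ ℝ))
    (hA : ∀ x y, x ≠ y → ∃ g ∈ A, g x ≠ g y)
    (hAΦ : ∀ g ∈ A, ∃ ℓ : H, ∀ x, g x = inner ℝ ℓ (Φ x)) : IsUniversal Φ := by
  obtain ⟨C, hC⟩ := hb
  refine ⟨fun ℓ => ⟨BoundedContinuousFunction.ofNormedAddCommGroup (fun x => inner ℝ ℓ (Φ x))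
    (by fun_prop) (‖ℓ‖ * C) fun x => ?_, fun x => rfl⟩, ?_⟩
  · exact (norm_inner_le_norm _ _).trans (mul_le_mul_of_nonneg_left (hC x) (norm_nonneg _))
  · exact @Dense.mono (X →ᵇ ℝ) (strictTopology X) _ _ hAΦ (dense_strictTopology_subalgebra A hA)

end Measures

/-! ### Decomposing tuples of points into products of permuted simplices -/

section Tuples

variable {d m : ℕ}

/-- Tuples of `m` points of the cube `[0,1]^d`; the `i`-th point is `fun j => t j i`. -/
def unitTuples (d m : ℕ) : Set (Fin d → Fin m → ℝ) :=
  Set.pi univ fun _ => Set.pi univ fun _ => Icc (0 : ℝ) 1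

theorem mem_unitTuples {t : Fin d → Fin m → ℝ} :
    t ∈ unitTuples d m ↔ ∀ j i, t j i ∈ Icc (0 : ℝ) 1 := by
  simp only [unitTuples, mem_univ_pi]

theorem measurableSet_unitTuples : MeasurableSet (unitTuples d m) :=
  MeasurableSet.univ_pi fun _ => MeasurableSet.univ_pi fun _ => measurableSet_Icc

theorem volume_unitTuples : volume (unitTuples d m) = 1 := by
  rw [unitTuples, volume_pi_pi]
  simp [Real.volume_Icc_pi]

theorem measurableSet_sigDomain (π : Fin d → Equiv.Perm (Fin m)) :
    MeasurableSet (sigDomain π) := by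
  rw [sigDomain_eq]
  exact MeasurableSet.univ_pi fun j => measurableSet_permSimplex (π j)

theorem sigDomain_subset_unitTuples (π : Fin d → Equiv.Perm (Fin m)) :
    sigDomain π ⊆ unitTuples d m := fun _ ht => mem_unitTuples.2 fun j => (ht j).2

/-- Transfers almost-everywhere statements about minors on the cube to each point of a tuple. -/
theorem measurePreserving_eval_unitTuples (i : Fin m) : MeasurePreserving
    (fun (t : Fin d → Fin m → ℝ) (j : Fin d) => t j i)
    (volume.restrict (unitTuples d m)) (volume.restrict (Icc (0 : Fin d → ℝ) 1)) := by
  have hprob : IsProbabilityMeasure (volume.restrict (Icc (0 : ℝ) 1)) := ⟨by simp⟩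
  rw [← Set.pi_univ_Icc, unitTuples, volume_pi, volume_pi, Measure.restrict_pi_pi,
    Measure.restrict_pi_pi, volume_pi, Measure.restrict_pi_pi]
  exact measurePreserving_pi _ _ fun _ => measurePreserving_eval _ i

theorem ae_unitTuples_of_ae_cube {p : (Fin d → ℝ) → Prop}
    (hp : ∀ᵐ s ∂volume.restrict (Icc (0 : Fin d → ℝ) 1), p s) :
    ∀ᵐ t ∂volume.restrict (unitTuples d m), ∀ i, p fun j => t j i :=
  ae_all_iff.2 fun i => (measurePreserving_eval_unitTuples i).quasiMeasurePreserving.ae hp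

/-- Each tie `t j i = t j k` cuts out a proper linear subspace, which is null. -/
theorem ae_injective : ∀ᵐ t : Fin d → Fin m → ℝ, ∀ j, Function.Injective (t j) := by
  have h : ∀ (j : Fin d) (i k : Fin m), i ≠ k → ∀ᵐ t : Fin d → Fin m → ℝ, t j i ≠ t j k := by
    intro j i k hik
    let p : Fin m → (Fin m → ℝ) →ₗ[ℝ] ℝ := fun l => LinearMap.proj l
    let q : (Fin d → Fin m → ℝ) →ₗ[ℝ] (Fin m → ℝ) := LinearMap.proj j
    let L : (Fin d → Fin m → ℝ) →ₗ[ℝ] ℝ := (p i - p k) ∘ₗ q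
    have hL : ∀ t, L t = t j i - t j k := fun t => rfl
    have hne : LinearMap.ker L ≠ ⊤ := by
      intro htop
      have h1 : L (fun _ => Pi.single i 1) = 0 := by
        rw [LinearMap.ker_eq_top.1 htop]; rfl
      rw [hL] at h1
      simp [hik.symm] at h1
    have h0 := Measure.addHaar_submodule volume (LinearMap.ker L) hne
    rw [ae_iff]
    convert h0 using 2
    ext t
    simp [hL, sub_eq_zero]
  have hall : ∀ᵐ t : Fin d → Fin m → ℝ, ∀ j i k, i ≠ k → t j i ≠ t j k := by
    simp only [ae_all_iff]
    exact h
  filter_upwards [hall] with t ht j i k hik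
  by_contra hne
  exact ht j i k hne hik

theorem exists_mem_sigDomain {t : Fin d → Fin m → ℝ} (ht : t ∈ unitTuples d m)
    (hinj : ∀ j, Function.Injective (t j)) : ∃ π : Fin d → Equiv.Perm (Fin m), t ∈ sigDomain π :=
  ⟨fun j => Tuple.sort (t j), fun j => ⟨(Tuple.monotone_sort (t j)).strictMono_of_injective
    ((hinj j).comp (Tuple.sort (t j)).injective), mem_unitTuples.1 ht j⟩⟩

theorem lt_iff_of_mem_permSimplex {π : Equiv.Perm (Fin m)} {t : Fin m → ℝ}
    (ht : t ∈ permSimplex π) (a b : Fin m) : t a < t b ↔ π.symm a < π.symm b := by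
  have := ht.1.lt_iff_lt (a := π.symm a) (b := π.symm b)
  simpa using this

theorem eq_of_mem_permSimplex {σ τ : Equiv.Perm (Fin m)} {t : Fin m → ℝ}
    (hσ : t ∈ permSimplex σ) (hτ : t ∈ permSimplex τ) : σ = τ := by
  have hmono : StrictMono (τ⁻¹ * σ : Equiv.Perm (Fin m)) := fun i j hij => by
    have h := (lt_iff_of_mem_permSimplex hτ (σ i) (σ j)).1 (hσ.1 hij)
    exact h
  have h1 : τ⁻¹ * σ = 1 := by
    refine Equiv.ext fun i => ?_
    have h2 := Subsingleton.elim
      (StrictMono.orderIsoOfSurjective _ hmono (τ⁻¹ * σ).surjective) (OrderIso.refl (Fin m))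
    exact congrArg (fun f : Fin m ≃o Fin m => f i) h2
  exact (inv_mul_eq_one.1 h1).symm

theorem pairwise_disjoint_sigDomain :
    Pairwise (Function.onFun Disjoint
      (sigDomain : (Fin d → Equiv.Perm (Fin m)) → Set (Fin d → Fin m → ℝ))) := fun _ _ hne =>
  Set.disjoint_left.2 fun _ h1 h2 => hne (funext fun j => eq_of_mem_permSimplex (h1 j) (h2 j))

/-- A condition that depends only on the order of the coordinates cuts out a union of products of
permuted simplices. -/
theorem subset_or_disjoint_sigDomain {G : Set (Fin d → Fin m → ℝ)}
    (hG : ∀ t ∈ unitTuples d m, ∀ t' ∈ unitTuples d m,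
      (∀ j a b, t j a < t j b ↔ t' j a < t' j b) → t ∈ G → t' ∈ G)
    (σ : Fin d → Equiv.Perm (Fin m)) : sigDomain σ ⊆ G ∨ Disjoint (sigDomain σ) G := by
  by_cases h : Disjoint (sigDomain σ) G
  · exact Or.inr h
  · obtain ⟨t, ht, htG⟩ := Set.not_disjoint_iff.1 h
    refine Or.inl fun t' ht' => hG t (sigDomain_subset_unitTuples σ ht) t'
      (sigDomain_subset_unitTuples σ ht') (fun j a b => ?_) htG
    rw [lt_iff_of_mem_permSimplex (ht j), lt_iff_of_mem_permSimplex (ht' j)]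

open Classical in
-- The simplices are defined by strict inequalities, so they miss exactly the tuples with ties.
-- Those form a null set.
theorem setIntegral_unitTuples_inter {G : Set (Fin d → Fin m → ℝ)}
    (hG : ∀ σ : Fin d → Equiv.Perm (Fin m), sigDomain σ ⊆ G ∨ Disjoint (sigDomain σ) G)
    {F : (Fin d → Fin m → ℝ) → ℝ} (hF : IntegrableOn F (unitTuples d m)) :
    ∫ t in unitTuples d m ∩ G, F t =
      ∑ σ : Fin d → Equiv.Perm (Fin m) with sigDomain σ ⊆ G, ∫ t in sigDomain σ, F t := by
  rw [← integral_biUnion_finset _ (fun σ _ => measurableSet_sigDomain σ)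
    (fun σ _ τ _ h => pairwise_disjoint_sigDomain h)
    (fun σ _ => hF.mono_set (sigDomain_subset_unitTuples σ))]
  refine setIntegral_congr_set ?_
  filter_upwards [ae_injective] with t ht
  refine propext ⟨fun ⟨h1, h2⟩ => ?_, fun h => ?_⟩
  · obtain ⟨σ, hσ⟩ := exists_mem_sigDomain h1 ht
    refine mem_iUnion₂.2 ⟨σ, ?_, hσ⟩
    simp only [Finset.mem_filter, Finset.mem_univ, true_and]
    exact (hG σ).resolve_right fun hd => Set.disjoint_left.1 hd hσ h2
  · obtain ⟨σ, hσ, ht'⟩ := mem_iUnion₂.1 h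
    simp only [Finset.mem_filter, Finset.mem_univ, true_and] at hσ
    exact ⟨sigDomain_subset_unitTuples σ ht', hσ ht'⟩

end Tuples

/-! ### Measure-preserving splittings of tuples -/

section Split

/-- Splitting every entry of a family along a measurable equivalence with a product. -/
def arrowSplit (ι : Type*) {α β γ : Type*} [MeasurableSpace α] [MeasurableSpace β]
    [MeasurableSpace γ] (e : α ≃ᵐ β × γ) : (ι → α) ≃ᵐ (ι → β) × (ι → γ) :=
  (MeasurableEquiv.piCongrRight fun _ : ι => e).trans
    (MeasurableEquiv.arrowProdEquivProdArrow β γ ι)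

theorem measurePreserving_arrowSplit (ι : Type*) [Fintype ι] {α β γ : Type*} [MeasureSpace α]
    [MeasureSpace β] [MeasureSpace γ] [SigmaFinite (volume : Measure β)]
    [SigmaFinite (volume : Measure γ)] (e : α ≃ᵐ β × γ) (he : MeasurePreserving e) :
    MeasurePreserving (arrowSplit ι e) :=
  (volume_measurePreserving_arrowProdEquivProdArrow β γ ι).comp
    (volume_preserving_pi fun _ : ι => he)

/-- Splitting a tuple of length `m + k` into its first `m` and its last `k` entries. -/
def appendSplit (m k : ℕ) : (Fin (m + k) → ℝ) ≃ᵐ (Fin m → ℝ) × (Fin k → ℝ) :=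
  (MeasurableEquiv.piCongrLeft (fun _ => ℝ) finSumFinEquiv).symm.trans
    (MeasurableEquiv.sumPiEquivProdPi fun _ => ℝ)

theorem measurePreserving_appendSplit (m k : ℕ) : MeasurePreserving (appendSplit m k) :=
  (volume_measurePreserving_sumPiEquivProdPi fun _ : Fin m ⊕ Fin k => ℝ).comp
    ((volume_measurePreserving_piCongrLeft (fun _ : Fin (m + k) => ℝ) finSumFinEquiv).symm _)

end Split

/-! ### The shuffle relation -/

section Shuffle

variable {d n : ℕ} {V : Type*} [NormedAddCommGroup V] [InnerProductSpace ℝ V]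

theorem measurable_prod_minor (b : OrthonormalBasis (Fin n) ℝ V) (x : LipMap d V) {m : ℕ}
    (P : Fin m → OrdInj d n) :
    Measurable fun t : Fin d → Fin m → ℝ => ∏ i, minor b x (P i) (fun j => t j i) :=
  Finset.measurable_fun_prod _ fun i _ => (measurable_minor b x (P i)).comp (by fun_prop)

theorem integrableOn_prod_minor (b : OrthonormalBasis (Fin n) ℝ V) (x : LipMap d V) {m : ℕ}
    (P : Fin m → OrdInj d n) :
    IntegrableOn (fun t : Fin d → Fin m → ℝ => ∏ i, minor b x (P i) (fun j => t j i))
      (unitTuples d m) := by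
  obtain ⟨B, hB0, hB⟩ := exists_abs_minor_le b x
  refine IntegrableOn.of_bound (by simp [volume_unitTuples])
    (measurable_prod_minor b x P).aestronglyMeasurable (B ^ m)
    (Filter.Eventually.of_forall fun t => ?_)
  rw [norm_prod]
  refine (Finset.prod_le_prod (fun _ _ => norm_nonneg _) fun i _ => hB (P i) _).trans ?_
  simp

/-- The shuffle relation: the product of two monomials is a sum of monomials. -/
theorem monomial_mul_monomial (b : OrthonormalBasis (Fin n) ℝ V) {m k : ℕ}
    (P : Fin m → OrdInj d n) (Q : Fin k → OrdInj d n) (π : Fin d → Equiv.Perm (Fin m))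
    (ρ : Fin d → Equiv.Perm (Fin k)) :
    ∃ S : Finset (Fin d → Equiv.Perm (Fin (m + k))), ∀ x : LipMap d V,
      monomial b x P π * monomial b x Q ρ = ∑ σ ∈ S, monomial b x (Fin.append P Q) σ := by
  classical
  set e := arrowSplit (Fin d) (appendSplit m k) with he
  have hmp : MeasurePreserving e :=
    measurePreserving_arrowSplit _ _ (measurePreserving_appendSplit m k)
  -- The product domain viewed inside tuples of length `m + k`. It constrains the order within each
  -- block but not between blocks, so the products of simplices it contains are indexed by tuples of
  -- shuffles.
  set G : Set (Fin d → Fin (m + k) → ℝ) := e ⁻¹' (sigDomain π ×ˢ sigDomain ρ) with hG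
  have hmem : ∀ t, t ∈ G ↔ ∀ j, (fun i => t j (Fin.castAdd k i)) ∈ permSimplex (π j) ∧
      (fun i => t j (Fin.natAdd m i)) ∈ permSimplex (ρ j) := by
    intro t
    exact forall_and.symm
  -- The index set depends only on `π` and `ρ`, not on `x`, so the relation is an identity between
  -- functions of `x`.
  refine ⟨Finset.univ.filter fun σ => sigDomain σ ⊆ G, fun x => ?_⟩
  have hGsub : G ⊆ unitTuples d (m + k) := by
    intro t ht
    rw [hmem] at ht
    refine mem_unitTuples.2 fun j i => ?_
    induction i using Fin.addCases with
    | left i => exact (ht j).1.2 i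
    | right i => exact (ht j).2.2 i
  have hsplit : ∀ σ, sigDomain σ ⊆ G ∨ Disjoint (sigDomain σ) G := by
    refine subset_or_disjoint_sigDomain fun t ht t' ht' hord htG => ?_
    rw [hmem] at htG ⊢
    rw [mem_unitTuples] at ht'
    exact fun j => ⟨⟨fun a b hab => (hord _ _ _).1 ((htG j).1.1 hab), fun _ => ht' _ _⟩,
      ⟨fun a b hab => (hord _ _ _).1 ((htG j).2.1 hab), fun _ => ht' _ _⟩⟩
  unfold monomial
  rw [← setIntegral_unitTuples_inter hsplit (integrableOn_prod_minor b x (Fin.append P Q)),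
    inter_eq_self_of_subset_right hGsub, ← setIntegral_prod_mul, ← Measure.volume_eq_prod,
    ← hmp.setIntegral_preimage_emb e.measurableEmbedding]
  refine setIntegral_congr_fun
    (e.measurable ((measurableSet_sigDomain π).prod (measurableSet_sigDomain ρ))) fun t _ => ?_
  simp only [Fin.prod_univ_add, Fin.append_left, Fin.append_right]
  rfl

end Shuffle

/-! ### Estimates for minors, monomials and tensor levels -/

section Estimates

variable {d n : ℕ} {V : Type*} [NormedAddCommGroup V] [InnerProductSpace ℝ V]

theorem ae_norm_le_norm_Lp_top {α E : Type*} [MeasurableSpace α] {μ : Measure α}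
    [NormedAddCommGroup E] (f : Lp E ∞ μ) : ∀ᵐ a ∂μ, ‖f a‖ ≤ ‖f‖ := by
  rw [Lp.norm_def, eLpNorm_exponent_top]
  have h := Lp.eLpNorm_ne_top f
  rw [eLpNorm_exponent_top] at h
  filter_upwards [ae_le_eLpNormEssSup (f := f) (μ := μ)] with a ha
  have h1 := ENNReal.toReal_mono h ha
  rwa [toReal_enorm] at h1

theorem ae_abs_minor_le (b : OrthonormalBasis (Fin n) ℝ V) (x : LipMap d V) :
    ∀ᵐ s ∂volume.restrict (Icc (0 : Fin d → ℝ) 1), ∀ P, |minor b x P s| ≤ ‖jacobianMinor b x‖ := by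
  filter_upwards [ae_norm_le_norm_Lp_top (jacobianMinor b x),
    (memLp_jacobianAt b x).coeFn_toLp] with s h1 h2 P
  rw [jacobianMinor, h2] at h1
  exact (PiLp.norm_apply_le (jacobianAt b x s) P).trans h1

theorem ae_abs_minor_sub_le (b : OrthonormalBasis (Fin n) ℝ V) (x y : LipMap d V) :
    ∀ᵐ s ∂volume.restrict (Icc (0 : Fin d → ℝ) 1), ∀ P,
      |minor b x P s - minor b y P s| ≤ ‖jacobianMinor b x - jacobianMinor b y‖ := by
  filter_upwards [ae_norm_le_norm_Lp_top (jacobianMinor b x - jacobianMinor b y),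
    (memLp_jacobianAt b x).coeFn_toLp, (memLp_jacobianAt b y).coeFn_toLp,
    Lp.coeFn_sub (jacobianMinor b x) (jacobianMinor b y)] with s h1 h2 h3 h4 P
  rw [h4, Pi.sub_apply, jacobianMinor, jacobianMinor, h2, h3] at h1
  exact (PiLp.norm_apply_le (jacobianAt b x s - jacobianAt b y s) P).trans h1

/-- In the open cube the retraction is the identity, so the relevant Jacobian matrix is the identity
matrix. The boundary, where the extension may fail to be differentiable, is null. -/
theorem ae_minor_paramIndex (b : OrthonormalBasis (Fin n) ℝ V) (x : LipMap d V) :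
    ∀ᵐ s ∂volume.restrict (Icc (0 : Fin d → ℝ) 1),
      minor (augBasis d b) (augment x) (paramIndex d n) s = 1 := by
  have h : (Set.pi univ fun _ : Fin d => Ioo (0 : ℝ) 1) =ᵐ[volume] Icc (0 : Fin d → ℝ) 1 :=
    Measure.univ_pi_Ioo_ae_eq_Icc
  rw [← Measure.restrict_congr_set h]
  have hopen : IsOpen (Set.pi univ fun _ : Fin d => Ioo (0 : ℝ) 1) :=
    isOpen_set_pi finite_univ fun _ _ => isOpen_Ioo
  filter_upwards [ae_restrict_mem hopen.measurableSet] with s hs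
  have hpd : ∀ i j, pderiv (augBasis d b) (augment x) (paramIndex d n i) j s =
      (1 : Matrix (Fin d) (Fin d) ℝ) i j := by
    intro i j
    have heq : (fun u => (augBasis d b).repr ((augment x).ext u) (paramIndex d n i)) =ᶠ[𝓝 s]
        fun u => u i := by
      filter_upwards [hopen.mem_nhds hs] with u hu
      rw [paramIndex, Fin.castAddOrderEmb_apply, repr_augment_castAdd]
      exact congrArg Subtype.val (projIcc_of_mem zero_le_one (Ioo_subset_Icc_self (hu i (mem_univ i))))
    rw [pderiv, heq.fderiv_eq, (hasFDerivAt_apply i s).fderiv]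
    simp [Matrix.one_apply, Pi.single_apply]
  have hmat : (Matrix.of fun i j : Fin d =>
      pderiv (augBasis d b) (augment x) (paramIndex d n i) j s) = 1 := by
    ext i j
    exact hpd i j
  rw [minor, hmat, Matrix.det_one]

/-- The restriction to `paramW` matters here: its minors are either 1 or minors of `x`. Mixed minors
involve lower-order minors of `x`, which `jacobianMinor` does not control in general. -/
theorem ae_abs_augment_minor_le (b : OrthonormalBasis (Fin n) ℝ V) (x : LipMap d V) {B : ℝ}
    (hB1 : 1 ≤ B) (hB : ‖jacobianMinor b x‖ ≤ B) :
    ∀ᵐ s ∂volume.restrict (Icc (0 : Fin d → ℝ) 1), ∀ P ∈ paramW d n,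
      |minor (augBasis d b) (augment x) P s| ≤ B := by
  filter_upwards [ae_abs_minor_le b x, ae_minor_paramIndex b x] with s h1 h2 P hP
  rcases hP with hP | ⟨Q, rfl⟩
  · rw [mem_singleton_iff.1 hP, h2, abs_one]
    exact hB1
  · rw [minor_shiftIndex]
    exact (h1 Q).trans hB

theorem ae_abs_augment_minor_sub_le (b : OrthonormalBasis (Fin n) ℝ V) (x y : LipMap d V) :
    ∀ᵐ s ∂volume.restrict (Icc (0 : Fin d → ℝ) 1), ∀ P ∈ paramW d n,
      |minor (augBasis d b) (augment x) P s - minor (augBasis d b) (augment y) P s| ≤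
        ‖jacobianMinor b x - jacobianMinor b y‖ := by
  filter_upwards [ae_abs_minor_sub_le b x y] with s h1 P hP
  rcases hP with hP | ⟨Q, rfl⟩
  · rw [mem_singleton_iff.1 hP, minor_paramIndex b x y, sub_self, abs_zero]
    exact norm_nonneg _
  · rw [minor_shiftIndex, minor_shiftIndex]
    exact h1 Q

theorem abs_prod_sub_prod_le {ι : Type*} (s : Finset ι) {u v : ι → ℝ} {B δ : ℝ} (hB : 1 ≤ B)
    (hu : ∀ i ∈ s, |u i| ≤ B) (hv : ∀ i ∈ s, |v i| ≤ B) (huv : ∀ i ∈ s, |u i - v i| ≤ δ) :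
    |∏ i ∈ s, u i - ∏ i ∈ s, v i| ≤ s.card * B ^ s.card * δ := by
  classical
  induction s using Finset.induction_on with
  | empty => simp
  | insert a s ha ih =>
    have hδ : 0 ≤ δ := (abs_nonneg _).trans (huv a (Finset.mem_insert_self a s))
    have ih' := ih (fun i hi => hu i (Finset.mem_insert_of_mem hi))
      (fun i hi => hv i (Finset.mem_insert_of_mem hi))
      (fun i hi => huv i (Finset.mem_insert_of_mem hi))
    have hprod : |∏ i ∈ s, u i| ≤ B ^ s.card := by
      rw [Finset.abs_prod]
      exact (Finset.prod_le_prod (fun _ _ => abs_nonneg _)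
        fun i hi => hu i (Finset.mem_insert_of_mem hi)).trans (by simp)
    rw [Finset.prod_insert ha, Finset.prod_insert ha, Finset.card_insert_of_notMem ha]
    -- Telescoping. Using `B ≥ 1`, the exponent is rounded up from `card - 1` to `card`, which makes
    -- the induction uniform.
    have hsplit : u a * ∏ i ∈ s, u i - v a * ∏ i ∈ s, v i =
        (u a - v a) * ∏ i ∈ s, u i + v a * (∏ i ∈ s, u i - ∏ i ∈ s, v i) := by ring
    rw [hsplit]
    refine (abs_add_le _ _).trans ?_
    rw [abs_mul, abs_mul]
    have h1 : |u a - v a| * |∏ i ∈ s, u i| ≤ δ * B ^ s.card :=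
      mul_le_mul (huv a (Finset.mem_insert_self a s)) hprod (abs_nonneg _) hδ
    have h2 : |v a| * |∏ i ∈ s, u i - ∏ i ∈ s, v i| ≤ B * (s.card * B ^ s.card * δ) :=
      mul_le_mul (hv a (Finset.mem_insert_self a s)) ih' (abs_nonneg _) (by linarith)
    have h3 : δ * B ^ s.card ≤ δ * (B * B ^ s.card) :=
      mul_le_mul_of_nonneg_left (le_mul_of_one_le_left (by positivity) hB) hδ
    push_cast
    rw [pow_succ]
    linarith

theorem abs_setIntegral_sigDomain_le {m : ℕ} (π : Fin d → Equiv.Perm (Fin m))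
    {F : (Fin d → Fin m → ℝ) → ℝ} {C : ℝ} (hC : 0 ≤ C)
    (hF : ∀ᵐ t ∂volume.restrict (unitTuples d m), |F t| ≤ C) :
    |∫ t in sigDomain π, F t| ≤ C * ((m.factorial : ℝ)⁻¹) ^ d := by
  have hv := volume_sigDomain_le π
  have hfin : ((m.factorial : ℝ≥0∞))⁻¹ ^ d ≠ ∞ :=
    ENNReal.pow_ne_top (ENNReal.inv_ne_top.2 (by exact_mod_cast m.factorial_ne_zero))
  have h1 : ‖∫ t in sigDomain π, F t‖ ≤ C * volume.real (sigDomain π) :=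
    norm_setIntegral_le_of_norm_le_const_ae (hv.trans_lt hfin.lt_top)
      (ae_restrict_of_ae_restrict_of_subset (sigDomain_subset_unitTuples π) hF)
  refine h1.trans (mul_le_mul_of_nonneg_left ?_ hC)
  have h2 := ENNReal.toReal_mono hfin hv
  simpa [Measure.real] using h2

theorem abs_monomial_augment_sub_le (b : OrthonormalBasis (Fin n) ℝ V) (x y : LipMap d V) {B : ℝ}
    (hB1 : 1 ≤ B) (hx : ‖jacobianMinor b x‖ ≤ B) (hy : ‖jacobianMinor b y‖ ≤ B) {m : ℕ}
    {P : Fin m → OrdInj d (d + n)} (hP : ∀ i, P i ∈ paramW d n)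
    (π : Fin d → Equiv.Perm (Fin m)) :
    |monomial (augBasis d b) (augment x) P π - monomial (augBasis d b) (augment y) P π| ≤
      (2 * B) ^ m * ‖jacobianMinor b x - jacobianMinor b y‖ * ((m.factorial : ℝ)⁻¹) ^ d := by
  unfold monomial
  rw [← integral_sub
    ((integrableOn_prod_minor _ _ P).mono_set (sigDomain_subset_unitTuples π))
    ((integrableOn_prod_minor _ _ P).mono_set (sigDomain_subset_unitTuples π))]
  refine abs_setIntegral_sigDomain_le π (by positivity) ?_
  filter_upwards [ae_unitTuples_of_ae_cube (ae_abs_augment_minor_le b x hB1 hx),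
    ae_unitTuples_of_ae_cube (ae_abs_augment_minor_le b y hB1 hy),
    ae_unitTuples_of_ae_cube (ae_abs_augment_minor_sub_le b x y)] with t h1 h2 h3
  refine (abs_prod_sub_prod_le Finset.univ hB1 (fun i _ => h1 i (P i) (hP i))
    (fun i _ => h2 i (P i) (hP i)) fun i _ => h3 i (P i) (hP i)).trans ?_
  rw [Finset.card_univ, Fintype.card_fin, mul_pow]
  -- The linear factor from telescoping is absorbed in the base of the power.
  have hm : (m : ℝ) ≤ 2 ^ m := by exact_mod_cast Nat.lt_two_pow_self.le
  gcongr

theorem norm_sq_permTensor_apply_le {N m : ℕ} (r : PermTensor d N m) {D : ℝ}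
    (hr : ∀ π P, |r π P| ≤ D * ((m.factorial : ℝ)⁻¹) ^ d) (π : Fin d → Equiv.Perm (Fin m)) :
    ‖r π‖ ^ 2 ≤ (Fintype.card (OrdInj d N) : ℝ) ^ m * (D / (m.factorial : ℝ) ^ d) ^ 2 := by
  rw [EuclideanSpace.norm_sq_eq]
  refine (Finset.sum_le_sum fun P _ => pow_le_pow_left₀ (norm_nonneg _) (hr π P) 2).trans ?_
  simp [div_eq_mul_inv]

/-- Summing over the `(m!)^d` choices of `π` cancels one of the two factors `(m!)^(-d)` of the
squared bound. This is why a whole level decays more slowly than a single `π`-component. -/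
theorem norm_sq_permTensor_le {N m : ℕ} (r : PermTensor d N m) {D : ℝ}
    (hr : ∀ π P, |r π P| ≤ D * ((m.factorial : ℝ)⁻¹) ^ d) :
    ‖r‖ ^ 2 ≤ (Fintype.card (OrdInj d N) : ℝ) ^ m * D ^ 2 / (m.factorial : ℝ) ^ d := by
  rw [PiLp.norm_sq_eq_of_L2]
  refine (Finset.sum_le_sum fun π _ => norm_sq_permTensor_apply_le r hr π).trans ?_
  have h : (m.factorial : ℝ) ≠ 0 := by positivity
  simp only [Finset.sum_const, Finset.card_univ, Fintype.card_pi, Finset.prod_const,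
    Fintype.card_perm, Fintype.card_fin, nsmul_eq_mul, Nat.cast_pow]
  field_simp
  rfl

end Estimates

/-! ### Continuity and factorial decay of the signature -/

section Regularity

variable {d n : ℕ} {V : Type*} [NormedAddCommGroup V] [InnerProductSpace ℝ V]

/-- The Jacobian equivalence class of a Lipschitz map. -/
def LipJ.mk (b : OrthonormalBasis (Fin n) ℝ V) (x : LipMap d V) : LipJ d b := Quotient.mk _ x

theorem LipJ.exists_mk (b : OrthonormalBasis (Fin n) ℝ V) (x : LipJ d b) :
    ∃ y, LipJ.mk b y = x := Quotient.exists_rep x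

theorem dist_lipJ_mk (b : OrthonormalBasis (Fin n) ℝ V) (x y : LipMap d V) :
    dist (LipJ.mk b x) (LipJ.mk b y) =
      ‖jacobianMinor b x - jacobianMinor b y‖ := dist_eq_norm (jacobianMinor b x) _

variable [NeZero d]

open Classical in
theorem paramSignature_mk_apply (b : OrthonormalBasis (Fin n) ℝ V) (x : LipMap d V) (m : ℕ)
    (π : Fin d → Equiv.Perm (Fin m)) (P : Fin m → OrdInj d (d + n)) :
    ((paramSignature b (LipJ.mk b x)).1 : ∀ m, PermTensor d (d + n) m) m π P =
      if ∀ i, P i ∈ paramW d n then monomial (augBasis d b) (augment x) P π else 0 := rfl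

theorem inv_factorial_pow_le (m : ℕ) : 1 / (m.factorial : ℝ) ^ d ≤ 1 / m.factorial :=
  one_div_le_one_div_of_le (by positivity)
    (le_self_pow₀ (by exact_mod_cast m.factorial_pos) (NeZero.ne d))

/-- A Lipschitz estimate whose constant depends on the maps only through `B`. It yields continuity
because `‖jacobianMinor b ·‖` is bounded on unit balls of the Jacobian metric. -/
theorem norm_paramSignature_sub_sq_le (b : OrthonormalBasis (Fin n) ℝ V) (x y : LipMap d V)
    {B : ℝ} (hB1 : 1 ≤ B) (hx : ‖jacobianMinor b x‖ ≤ B) (hy : ‖jacobianMinor b y‖ ≤ B) :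
    ‖(paramSignature b (LipJ.mk b x)).1 -
        (paramSignature b (LipJ.mk b y)).1‖ ^ 2 ≤
      (∑' m : ℕ, (Fintype.card (OrdInj d (d + n)) * (2 * B) ^ 2) ^ m / m.factorial) *
        ‖jacobianMinor b x - jacobianMinor b y‖ ^ 2 := by
  set δ := ‖jacobianMinor b x - jacobianMinor b y‖ with hδ
  set c : ℝ := (Fintype.card (OrdInj d (d + n)) : ℝ) with hc
  set r := (paramSignature b (LipJ.mk b x)).1 -
        (paramSignature b (LipJ.mk b y)).1 with hr
  have hcoord : ∀ m π P, |(r : ∀ m, PermTensor d (d + n) m) m π P| ≤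
      (2 * B) ^ m * δ * ((m.factorial : ℝ)⁻¹) ^ d := by
    intro m π P
    have h1 : (r : ∀ m, PermTensor d (d + n) m) m π P =
      ((paramSignature b (LipJ.mk b x)).1 : ∀ m, PermTensor d (d + n) m) m π P -
      ((paramSignature b (LipJ.mk b y)).1 : ∀ m, PermTensor d (d + n) m) m π P :=
      rfl
    rw [h1, paramSignature_mk_apply, paramSignature_mk_apply]
    split_ifs with hP
    · exact abs_monomial_augment_sub_le b x y hB1 hx hy hP π
    · rw [sub_self, abs_zero]; positivity
  have hlev : ∀ m, ‖(r : ∀ m, PermTensor d (d + n) m) m‖ ^ 2 ≤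
      (c * (2 * B) ^ 2) ^ m / m.factorial * δ ^ 2 := by
    intro m
    refine (norm_sq_permTensor_le _ (hcoord m)).trans ?_
    calc c ^ m * ((2 * B) ^ m * δ) ^ 2 / (m.factorial : ℝ) ^ d
        = (c * (2 * B) ^ 2) ^ m * δ ^ 2 * (1 / (m.factorial : ℝ) ^ d) := by
          rw [mul_pow c, ← pow_mul, mul_comm 2 m, pow_mul]; ring
      _ ≤ (c * (2 * B) ^ 2) ^ m * δ ^ 2 * (1 / m.factorial) :=
          mul_le_mul_of_nonneg_left (inv_factorial_pow_le m) (by positivity)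
      _ = _ := by ring
  have hsum := (Real.summable_pow_div_factorial (c * (2 * B) ^ 2)).mul_right (δ ^ 2)
  have hnorm : ‖r‖ ^ 2 = ∑' m, ‖(r : ∀ m, PermTensor d (d + n) m) m‖ ^ 2 := by
    have h := lp.norm_rpow_eq_tsum (p := 2) (by norm_num) r
    simpa using h
  rw [hnorm, ← tsum_mul_right]
  exact Summable.tsum_le_tsum hlev (hsum.of_nonneg_of_le (fun m => by positivity) hlev) hsum

theorem continuous_paramSignature (b : OrthonormalBasis (Fin n) ℝ V) :
    Continuous (paramSignature (d := d) b) := by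
  refine continuous_iff_continuousAt.2 fun x => ?_
  obtain ⟨x, rfl⟩ := LipJ.exists_mk b x
  set B : ℝ := ‖jacobianMinor b x‖ + 1 with hB
  set E : ℝ := ∑' m : ℕ, (Fintype.card (OrdInj d (d + n)) * (2 * B) ^ 2) ^ m / m.factorial
  have hE : 0 ≤ E := tsum_nonneg fun m => by positivity
  refine continuousAt_of_locally_lipschitz one_pos (Real.sqrt E) fun y hy => ?_
  obtain ⟨y, rfl⟩ := LipJ.exists_mk b y
  rw [dist_lipJ_mk] at hy ⊢
  have hyB : ‖jacobianMinor b y‖ ≤ B := by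
    have := norm_le_norm_add_norm_sub (jacobianMinor b x) (jacobianMinor b y)
    rw [norm_sub_rev] at this
    linarith
  rw [Subtype.dist_eq, dist_eq_norm]
  refine abs_le_of_sq_le_sq' ?_ (by positivity) |>.2
  rw [mul_pow, Real.sq_sqrt hE]
  exact norm_paramSignature_sub_sq_le b y x (by linarith [norm_nonneg (jacobianMinor b x)]) hyB
    (by linarith)

theorem abs_paramSignature_apply_le (b : OrthonormalBasis (Fin n) ℝ V) (x : LipJ d b) :
    ∃ B : ℝ, 0 ≤ B ∧ ∀ m π P,
      |((paramSignature b x).1 : ∀ m, PermTensor d (d + n) m) m π P| ≤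
        B ^ m * ((m.factorial : ℝ)⁻¹) ^ d := by
  obtain ⟨x, rfl⟩ := LipJ.exists_mk b x
  obtain ⟨B, hB0, hB⟩ := exists_abs_minor_le (augBasis d b) (augment x)
  refine ⟨B, hB0, fun m π P => ?_⟩
  rw [paramSignature_mk_apply]
  split_ifs
  · exact abs_monomial_le _ _ hB0 hB P π
  · rw [abs_zero]; positivity

theorem factorial_decay (b : OrthonormalBasis (Fin n) ℝ V)
    {ν : UnitPermHilbert d (d + n) → PermHilbert d (d + n)} (hν : IsGradedNormalization ν)
    (x : LipJ d b) : ∃ C : ℝ, 0 < C ∧ ∀ m : ℕ,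
      (∀ π : Fin d → Equiv.Perm (Fin m),
        ‖(ν (paramSignature b x) : ∀ m, PermTensor d (d + n) m) m π‖ ≤
          C ^ m / (m.factorial : ℝ) ^ d) ∧
      ‖(ν (paramSignature b x) : ∀ m, PermTensor d (d + n) m) m‖ ^ 2 ≤
        C ^ m / (m.factorial : ℝ) ^ d := by
  obtain ⟨scale, hscale⟩ := hν.scaling
  obtain ⟨hpos, hlev⟩ := hscale (paramSignature b x)
  obtain ⟨B, hB0, hB⟩ := abs_paramSignature_apply_le b x
  set a := scale (paramSignature b x) with ha
  set c : ℝ := (Fintype.card (OrdInj d (d + n)) : ℝ) with hc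
  have hc0 : 0 ≤ c := Nat.cast_nonneg _
  have hab : 0 ≤ a * B := by positivity
  have hcoord : ∀ m π P, |(ν (paramSignature b x) : ∀ m, PermTensor d (d + n) m) m π P| ≤
      (a * B) ^ m * ((m.factorial : ℝ)⁻¹) ^ d := by
    intro m π P
    rw [hlev m, PiLp.smul_apply, PiLp.smul_apply, smul_eq_mul, abs_mul, abs_of_pos (by positivity),
      mul_pow, mul_assoc]
    exact mul_le_mul_of_nonneg_left (hB m π P) (by positivity)
  have hcc : c ≤ (c + 1) ^ 2 := by nlinarith
  -- One constant has to serve both bounds. After squaring the first, they require `c * (a * B) ^ 2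
  -- ≤ C ^ 2` and `c * (a * B) ^ 2 ≤ C`; the added ones secure both.
  refine ⟨(c + 1) * (a * B + 1) ^ 2, by positivity, fun m => ⟨fun π => ?_, ?_⟩⟩
  · refine abs_le_of_sq_le_sq' ?_ (by positivity) |>.2
    refine (norm_sq_permTensor_apply_le _ (hcoord m) π).trans ?_
    rw [div_pow, div_pow, ← mul_div_assoc]
    refine div_le_div_of_nonneg_right ?_ (by positivity)
    rw [← pow_mul, ← pow_mul, mul_comm m 2, pow_mul, pow_mul, ← mul_pow, mul_pow (c + 1)]
    refine pow_le_pow_left₀ (by positivity) ?_ m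
    refine mul_le_mul hcc ?_ (by positivity) (by positivity)
    refine pow_le_pow_left₀ hab ?_ 2
    nlinarith
  · refine (norm_sq_permTensor_le _ (hcoord m)).trans ?_
    refine div_le_div_of_nonneg_right ?_ (by positivity)
    rw [← pow_mul, mul_comm m 2, pow_mul, ← mul_pow]
    refine pow_le_pow_left₀ (by positivity) ?_ m
    refine mul_le_mul (by linarith) ?_ (by positivity) (by positivity)
    exact pow_le_pow_left₀ hab (by linarith) 2

end Regularity

/-! ### Moments of functions on the cube -/

section Moments

variable {d : ℕ}

/-- The tuples `(s, t_1, …, t_M)` with `t_{i,j} < s_j` for `i ≤ k_j`. -/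
def momentSet (M : ℕ) (k : Fin d → ℕ) : Set (Fin d → Fin (M + 1) → ℝ) :=
  {t | ∀ j, ∀ i : Fin M, (i : ℕ) < k j → t j i.succ < t j 0}

/-- By Fubini: in direction `j`, the first `k j` of the `M` auxiliary coordinates range over `[0,
s_j)` and the others over `[0, 1]`, so they integrate out to `s_j ^ k j`. A common `M ≥ k j` lets
all directions share one tuple length. -/
theorem setIntegral_momentSet {f : (Fin d → ℝ) → ℝ}
    (hf : IntegrableOn f (Icc (0 : Fin d → ℝ) 1)) (M : ℕ) (k : Fin d → ℕ)
    (hk : ∀ j, k j ≤ M) :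
    ∫ t in unitTuples d (M + 1) ∩ momentSet M k, f (fun j => t j 0) =
      ∫ s in Icc (0 : Fin d → ℝ) 1, f s * ∏ j, s j ^ k j := by
  set e := arrowSplit (Fin d) (MeasurableEquiv.piFinSuccAbove (fun _ : Fin (M + 1) => ℝ) 0)
  have hmp : MeasurePreserving e :=
    measurePreserving_arrowSplit _ _ (volume_preserving_piFinSuccAbove (fun _ => ℝ) 0)
  have he : ∀ t, e t = (fun j => t j 0, fun j i => t j i.succ) := fun t => rfl
  set D : Set ((Fin d → ℝ) × (Fin d → Fin M → ℝ)) :=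
    {q | q.1 ∈ Icc (0 : Fin d → ℝ) 1 ∧ q.2 ∈ unitTuples d M ∧
      ∀ j, ∀ i : Fin M, (i : ℕ) < k j → q.2 j i < q.1 j} with hD
  have hDm : MeasurableSet D := by
    refine (measurable_fst measurableSet_Icc).inter
      ((measurable_snd measurableSet_unitTuples).inter ?_)
    have : {q : (Fin d → ℝ) × (Fin d → Fin M → ℝ) |
        ∀ j, ∀ i : Fin M, (i : ℕ) < k j → q.2 j i < q.1 j} =
        ⋂ j, ⋂ i : Fin M, ⋂ _ : (i : ℕ) < k j, {q | q.2 j i < q.1 j} := by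
      ext q; simp
    change MeasurableSet {q : (Fin d → ℝ) × (Fin d → Fin M → ℝ) |
        ∀ j, ∀ i : Fin M, (i : ℕ) < k j → q.2 j i < q.1 j}
    rw [this]
    exact MeasurableSet.iInter fun j => MeasurableSet.iInter fun i => MeasurableSet.iInter fun _ =>
      measurableSet_lt (by fun_prop) (by fun_prop)
  have hpre : unitTuples d (M + 1) ∩ momentSet M k = e ⁻¹' D := by
    ext t
    simp only [mem_inter_iff, mem_unitTuples, momentSet, mem_ofPred_eq, mem_preimage, hD, he,
      Fin.forall_fin_succ, mem_Icc, Pi.le_def, Pi.zero_apply, Pi.one_apply, forall_and]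
    tauto
  rw [hpre]
  have h1 := hmp.setIntegral_preimage_emb e.measurableEmbedding (fun q => f q.1) D
  simp only [he] at h1
  rw [h1, ← integral_indicator hDm, Measure.volume_eq_prod, integral_prod]
  · rw [← integral_indicator measurableSet_Icc]
    refine integral_congr_ae (Filter.Eventually.of_forall fun s => ?_)
    by_cases hs : s ∈ Icc (0 : Fin d → ℝ) 1
    -- The slice over `s` of the domain is a box.
    · set S : Set (Fin d → Fin M → ℝ) := Set.pi univ fun j => Set.pi univ fun i : Fin M =>
        if (i : ℕ) < k j then Ico 0 (s j) else Icc 0 1 with hS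
      have hSm : MeasurableSet S := MeasurableSet.univ_pi fun j => MeasurableSet.univ_pi fun i => by
        split_ifs
        exacts [measurableSet_Ico, measurableSet_Icc]
      have hslice : ∀ u, D.indicator (fun q => f q.1) (s, u) = S.indicator (fun _ => f s) u := by
        intro u
        have hiff : (s, u) ∈ D ↔ u ∈ S := by
          simp only [hD, hS, mem_ofPred_eq, hs, true_and, mem_unitTuples, mem_univ_pi]
          rw [← forall_and]
          refine forall_congr' fun j => ?_
          rw [← forall_and]
          refine forall_congr' fun i => ?_
          have := hs.2 j
          simp only [Pi.one_apply] at this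
          split_ifs with hi
          · exact ⟨fun h => ⟨h.1.1, h.2 hi⟩, fun h => ⟨⟨h.1, h.2.le.trans this⟩, fun _ => h.2⟩⟩
          · exact ⟨fun h => h.1, fun h => ⟨h, fun hi' => absurd hi' hi⟩⟩
        by_cases hu : u ∈ S
        · rw [indicator_of_mem (hiff.2 hu), indicator_of_mem hu]
        · rw [indicator_of_notMem (fun h => hu (hiff.1 h)), indicator_of_notMem hu]
      simp only [hslice]
      rw [integral_indicator hSm, setIntegral_const, indicator_of_mem hs, smul_eq_mul, mul_comm]
      congr 1
      rw [Measure.real, hS, volume_pi_pi, ENNReal.toReal_prod]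
      refine Finset.prod_congr rfl fun j _ => ?_
      rw [volume_pi_pi, ENNReal.toReal_prod]
      have hfac : ∀ i : Fin M, (volume (if (i : ℕ) < k j then Ico 0 (s j) else Icc 0 1)).toReal =
          if (i : ℕ) < k j then s j else 1 := by
        intro i
        split_ifs
        · rw [Real.volume_Ico, sub_zero, ENNReal.toReal_ofReal (hs.1 j)]
        · simp
      simp only [hfac]
      rw [Finset.prod_ite, Finset.prod_const_one, mul_one, Finset.prod_const]
      congr 1
      rw [Fin.card_filter_val_lt, min_eq_right (hk j)]
    · rw [indicator_of_notMem hs]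
      have : ∀ u, D.indicator (fun q => f q.1) (s, u) = 0 := fun u =>
        indicator_of_notMem (fun h => hs h.1) _
      simp [this]
  · rw [integrable_indicator_iff hDm, ← Measure.volume_eq_prod]
    have hsub : D ⊆ Icc (0 : Fin d → ℝ) 1 ×ˢ unitTuples d M := fun q hq => ⟨hq.1, hq.2.1⟩
    refine IntegrableOn.mono_set ?_ hsub
    rw [IntegrableOn, Measure.volume_eq_prod, ← Measure.prod_restrict]
    have : IsFiniteMeasure (volume.restrict (unitTuples d M)) := ⟨by simp [volume_unitTuples]⟩
    exact hf.comp_fst _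

theorem subset_or_disjoint_momentSet (M : ℕ) (k : Fin d → ℕ)
    (σ : Fin d → Equiv.Perm (Fin (M + 1))) :
    sigDomain σ ⊆ momentSet M k ∨ Disjoint (sigDomain σ) (momentSet M k) :=
  subset_or_disjoint_sigDomain (fun t _ _ _ hord ht => by
    have ht' : ∀ j, ∀ i : Fin M, (i : ℕ) < k j → t j i.succ < t j 0 := ht
    exact fun j i hi => (hord j _ _).1 (ht' j i hi)) σ

/-- A function on the cube with vanishing moments vanishes almost everywhere. -/
theorem ae_eq_zero_of_moments {f : (Fin d → ℝ) → ℝ}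
    (hf : IntegrableOn f (Icc (0 : Fin d → ℝ) 1))
    (h : ∀ k : Fin d → ℕ, ∫ s in Icc (0 : Fin d → ℝ) 1, f s * ∏ j, s j ^ k j = 0) :
    ∀ᵐ s ∂volume.restrict (Icc (0 : Fin d → ℝ) 1), f s = 0 := by
  have hpoly : ∀ p : MvPolynomial (Fin d) ℝ,
      ∫ s in Icc (0 : Fin d → ℝ) 1, f s * MvPolynomial.eval s p = 0 := by
    intro p
    simp only [MvPolynomial.eval_eq', Finset.mul_sum]
    rw [integral_finsetSum]
    · refine Finset.sum_eq_zero fun k _ => ?_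
      have h1 : ∀ s : Fin d → ℝ, f s * (p.coeff k * ∏ j, s j ^ k j) =
          p.coeff k * (f s * ∏ j, s j ^ k j) := fun s => by ring
      simp only [h1]
      rw [integral_const_mul, h, mul_zero]
    · intro k _
      exact hf.mul_continuousOn (by fun_prop) isCompact_Icc
  -- Polynomials are uniformly dense on the cube and `f` is integrable. The `+ 1` in `ε / (I + 1)`
  -- covers the case `I = 0`.
  have hcont : ∀ g : C(Fin d → ℝ, ℝ), ∫ s in Icc (0 : Fin d → ℝ) 1, f s * g s = 0 := by
    intro g
    let coord : Fin d → C(Fin d → ℝ, ℝ) := fun i => ⟨fun s => s i, continuous_apply i⟩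
    let φ : MvPolynomial (Fin d) ℝ →ₐ[ℝ] C(Fin d → ℝ, ℝ) := MvPolynomial.aeval coord
    have hφ : ∀ p s, φ p s = MvPolynomial.eval s p := by
      intro p s
      induction p using MvPolynomial.induction_on with
      | C a => simp [φ]
      | add p q hp hq => simp [hp, hq]
      | mul_X p i hp => simp [hp, φ, coord]
    have hsep : φ.range.SeparatesPoints := by
      intro s t hst
      obtain ⟨i, hi⟩ := Function.ne_iff.1 hst
      refine ⟨φ (MvPolynomial.X i), ⟨φ (MvPolynomial.X i), ⟨_, rfl⟩, rfl⟩, ?_⟩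
      simpa [hφ] using hi
    refine eq_of_abs_sub_le_all fun ε hε => ?_
    set I : ℝ := ∫ s in Icc (0 : Fin d → ℝ) 1, |f s| with hI
    have hI0 : 0 ≤ I := integral_nonneg fun s => abs_nonneg _
    obtain ⟨_, ⟨p, rfl⟩, hp⟩ :=
      ContinuousMap.exists_mem_subalgebra_near_continuous_of_isCompact_of_separatesPoints hsep g
        (isCompact_Icc (a := (0 : Fin d → ℝ)) (b := 1)) (ε := ε / (I + 1)) (by positivity)
    have hfg : IntegrableOn (fun s => f s * g s) (Icc (0 : Fin d → ℝ) 1) :=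
      hf.mul_continuousOn g.continuous.continuousOn isCompact_Icc
    have hfp : IntegrableOn (fun s => f s * MvPolynomial.eval s p) (Icc (0 : Fin d → ℝ) 1) :=
      hf.mul_continuousOn (MvPolynomial.continuous_eval p).continuousOn isCompact_Icc
    rw [sub_zero, ← sub_zero (∫ s in Icc (0 : Fin d → ℝ) 1, f s * g s), ← hpoly p,
      ← integral_sub hfg hfp]
    have hle : ∀ s ∈ Icc (0 : Fin d → ℝ) 1,
        ‖f s * g s - f s * MvPolynomial.eval s p‖ ≤ |f s| * (ε / (I + 1)) := by
      intro s hs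
      rw [← mul_sub, norm_mul, ← hφ, norm_sub_rev]
      exact mul_le_mul_of_nonneg_left (hp s hs).le (abs_nonneg _)
    calc |∫ s in Icc (0 : Fin d → ℝ) 1, (f s * g s - f s * MvPolynomial.eval s p)|
        ≤ ∫ s in Icc (0 : Fin d → ℝ) 1, |f s| * (ε / (I + 1)) :=
          norm_integral_le_of_norm_le (hf.abs.mul_const _)
            ((ae_restrict_iff' measurableSet_Icc).2 (Filter.Eventually.of_forall hle))
      _ = I * (ε / (I + 1)) := integral_mul_const _ _
      _ ≤ (I + 1) * (ε / (I + 1)) := mul_le_mul_of_nonneg_right (by linarith) (by positivity)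
      _ = ε := by field_simp
  -- The fundamental lemma of the calculus of variations, for the extension of `f` by zero.
  have hind : ∀ᵐ s, (Icc (0 : Fin d → ℝ) 1).indicator f s = 0 := by
    refine ae_eq_zero_of_integral_contDiff_smul_eq_zero
      ((integrable_indicator_iff measurableSet_Icc).2 hf).locallyIntegrable fun g hg _ => ?_
    have h1 := hcont ⟨g, hg.continuous⟩
    rw [← integral_indicator measurableSet_Icc] at h1
    rw [← h1]
    congr 1
    funext s
    by_cases hs : s ∈ Icc (0 : Fin d → ℝ) 1
    · rw [indicator_of_mem hs, indicator_of_mem hs, smul_eq_mul, mul_comm]; rfl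
    · rw [indicator_of_notMem hs, indicator_of_notMem hs, smul_zero]
  rw [ae_restrict_iff' measurableSet_Icc]
  filter_upwards [hind] with s hs hmem
  rwa [indicator_of_mem hmem] at hs

end Moments

/-! ### Injectivity of the parametrized signature -/

section Injectivity

variable {d n : ℕ} {V : Type*} [NormedAddCommGroup V] [InnerProductSpace ℝ V]

/-- The letters `U` contribute the factor 1, but their points remain in the domain of integration.
They are what produces polynomial weights. -/
theorem monomial_cons_paramIndex (b : OrthonormalBasis (Fin n) ℝ V) (x : LipMap d V)
    (P : OrdInj d n) {M : ℕ} (σ : Fin d → Equiv.Perm (Fin (M + 1))) :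
    monomial (augBasis d b) (augment x)
      (Fin.cons (shiftIndex P) fun _ => paramIndex d n : Fin (M + 1) → OrdInj d (d + n)) σ =
      ∫ t in sigDomain σ, minor b x P (fun j => t j 0) := by
  unfold monomial
  refine integral_congr_ae ?_
  filter_upwards [ae_restrict_of_ae_restrict_of_subset (sigDomain_subset_unitTuples σ)
    (ae_unitTuples_of_ae_cube (ae_minor_paramIndex b x))] with t ht
  rw [Fin.prod_univ_succ]
  simp only [Fin.cons_zero, Fin.cons_succ, ht, Finset.prod_const_one, mul_one, minor_shiftIndex]

theorem integrableOn_minor (b : OrthonormalBasis (Fin n) ℝ V) (x : LipMap d V)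
    (P : OrdInj d n) : IntegrableOn (minor b x P) (Icc (0 : Fin d → ℝ) 1) := by
  obtain ⟨B, -, hB⟩ := exists_abs_minor_le b x
  exact IntegrableOn.of_bound isCompact_Icc.measure_lt_top
    (measurable_minor b x P).aestronglyMeasurable B (Filter.Eventually.of_forall (hB P))

variable [NeZero d]

theorem paramSignature_injective (b : OrthonormalBasis (Fin n) ℝ V) :
    Function.Injective (paramSignature (d := d) b) := by
  intro x y hxy
  obtain ⟨x, rfl⟩ := LipJ.exists_mk b x
  obtain ⟨y, rfl⟩ := LipJ.exists_mk b y
  have hmon : ∀ {M : ℕ} (P : OrdInj d n) (σ : Fin d → Equiv.Perm (Fin (M + 1))),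
      ∫ t in sigDomain σ, minor b x P (fun j => t j 0) =
        ∫ t in sigDomain σ, minor b y P (fun j => t j 0) := by
    intro M P σ
    set Q : Fin (M + 1) → OrdInj d (d + n) := Fin.cons (shiftIndex P) fun _ => paramIndex d n
    have hQ : ∀ i, Q i ∈ paramW d n := by
      intro i
      induction i using Fin.cases with
      | zero => exact Or.inr ⟨P, rfl⟩
      | succ i => exact Or.inl rfl
    rw [← monomial_cons_paramIndex b x, ← monomial_cons_paramIndex b y]
    have hx := paramSignature_mk_apply b x (M + 1) σ Q
    have hy := paramSignature_mk_apply b y (M + 1) σ Q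
    rw [if_pos hQ] at hx hy
    rw [← hx, ← hy, hxy]
  have hzero : ∀ P, ∀ᵐ s ∂volume.restrict (Icc (0 : Fin d → ℝ) 1),
      minor b x P s - minor b y P s = 0 := by
    intro P
    have hint : IntegrableOn (fun s => minor b x P s - minor b y P s) (Icc (0 : Fin d → ℝ) 1) :=
      (integrableOn_minor b x P).sub (integrableOn_minor b y P)
    refine ae_eq_zero_of_moments hint fun k => ?_
    set M := Finset.univ.sup k
    have hcomp : ∀ z : LipMap d V, IntegrableOn (fun t : Fin d → Fin (M + 1) → ℝ =>
        minor b z P (fun j => t j 0)) (unitTuples d (M + 1)) := fun z =>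
      (measurePreserving_eval_unitTuples 0).integrable_comp_of_integrable (integrableOn_minor b z P)
    have hdiff : IntegrableOn (fun t : Fin d → Fin (M + 1) → ℝ =>
        minor b x P (fun j => t j 0) - minor b y P fun j => t j 0) (unitTuples d (M + 1)) :=
      (hcomp x).sub (hcomp y)
    -- The moment of the difference becomes a sum, over the products of simplices inside the moment
    -- set, of differences of equal signature coordinates.
    rw [← setIntegral_momentSet hint M k fun j => Finset.le_sup (Finset.mem_univ j),
      setIntegral_unitTuples_inter (subset_or_disjoint_momentSet M k) hdiff]
    refine Finset.sum_eq_zero fun σ _ => ?_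
    rw [integral_sub ((hcomp x).mono_set (sigDomain_subset_unitTuples σ))
      ((hcomp y).mono_set (sigDomain_subset_unitTuples σ)), hmon P σ, sub_self]
  refine Quotient.sound ?_
  refine (MemLp.toLp_eq_toLp_iff (memLp_jacobianAt b x) (memLp_jacobianAt b y)).2 ?_
  filter_upwards [ae_all_iff.2 hzero] with s hs
  exact congrArg (WithLp.toLp 2) (funext fun P => sub_eq_zero.1 (hs P))

end Injectivity

/-! ### The algebra of normalized coordinates -/

section Coordinates

theorem exists_inner_eq_apply {d N : ℕ} (m : ℕ) (π : Fin d → Equiv.Perm (Fin m))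
    (P : Fin m → OrdInj d N) :
    ∃ ℓ : PermHilbert d N, ∀ r : PermHilbert d N,
      inner ℝ ℓ r = (r : ∀ m, PermTensor d N m) m π P := by
  classical
  refine ⟨lp.single 2 m (WithLp.toLp 2 (Pi.single π (EuclideanSpace.single P 1))), fun r => ?_⟩
  rw [lp.inner_single_left, PiLp.inner_apply, Finset.sum_eq_single π]
  · simp [EuclideanSpace.inner_single_left]
  · intro ρ _ hρ
    simp [Pi.single_eq_of_ne hρ]
  · simp

variable {d n : ℕ} [NeZero d] {V : Type*} [NormedAddCommGroup V] [InnerProductSpace ℝ V]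
  (b : OrthonormalBasis (Fin n) ℝ V)
  {ν : UnitPermHilbert d (d + n) → PermHilbert d (d + n)}

/-- The bounded continuous functions that are linear combinations of coordinates of the normalized
signature. -/
def coordSpan (ν : UnitPermHilbert d (d + n) → PermHilbert d (d + n)) :
    Submodule ℝ (LipJ d b →ᵇ ℝ) :=
  Submodule.span ℝ {g | ∃ m π P, ∀ x,
    g x = (ν (paramSignature b x) : ∀ m, PermTensor d (d + n) m) m π P}

variable {b}

/-- The bound on the normalization is what makes each coordinate a bounded function. -/
theorem exists_coordinate (hν : IsGradedNormalization ν) (m : ℕ)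
    (π : Fin d → Equiv.Perm (Fin m)) (P : Fin m → OrdInj d (d + n)) :
    ∃ g ∈ coordSpan b ν, ∀ x,
      g x = (ν (paramSignature b x) : ∀ m, PermTensor d (d + n) m) m π P := by
  obtain ⟨ℓ, hℓ⟩ := exists_inner_eq_apply (N := d + n) m π P
  obtain ⟨C, -, hC⟩ := hν.bounded
  have hcont : Continuous fun x : LipJ d b => ν (paramSignature b x) :=
    hν.continuous.comp (continuous_paramSignature b)
  let g : LipJ d b →ᵇ ℝ := BoundedContinuousFunction.ofNormedAddCommGroup
    (fun x => inner ℝ ℓ (ν (paramSignature b x))) (continuous_const.inner hcont)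
    (‖ℓ‖ * C) fun x =>
      (norm_inner_le_norm _ _).trans (mul_le_mul_of_nonneg_left (hC _) (norm_nonneg _))
  have hg : ∀ x, g x = (ν (paramSignature b x) : ∀ m, PermTensor d (d + n) m) m π P :=
    fun x => hℓ _
  exact ⟨g, Submodule.subset_span ⟨m, π, P, hg⟩, hg⟩

/-- The unit is the level 0 coordinate, which the scaling `λ^0` leaves equal to 1. -/
theorem one_mem_coordSpan (hν : IsGradedNormalization ν) : 1 ∈ coordSpan b ν := by
  obtain ⟨scale, hscale⟩ := hν.scaling
  refine Submodule.subset_span ⟨0, fun _ => 1, Fin.elim0, fun x => ?_⟩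
  rw [(hscale _).2 0, pow_zero, one_smul, (paramSignature b x).2]
  rfl

theorem mul_mem_coordSpan (hν : IsGradedNormalization ν) {f g : LipJ d b →ᵇ ℝ}
    (hf : f ∈ coordSpan b ν) (hg : g ∈ coordSpan b ν) : f * g ∈ coordSpan b ν := by
  obtain ⟨scale, hscale⟩ := hν.scaling
  have happly : ∀ (x : LipMap d V) (m : ℕ) π P,
      (ν (paramSignature b (LipJ.mk b x)) : ∀ m, PermTensor d (d + n) m) m π P =
        scale (paramSignature b (LipJ.mk b x)) ^ m *
          ((paramSignature b (LipJ.mk b x)).1 : ∀ m, PermTensor d (d + n) m) m π P := by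
    intro x m π P
    rw [(hscale _).2 m]
    rfl
  have hmem := Submodule.mul_mem_mul hf hg
  rw [coordSpan, Submodule.span_mul_span] at hmem
  refine Submodule.span_le.2 ?_ hmem
  rintro _ ⟨f, ⟨m, π, P, hf⟩, g, ⟨k, ρ, Q, hg⟩, rfl⟩
  change f * g ∈ coordSpan b ν
  by_cases hPQ : (∀ i, P i ∈ paramW d n) ∧ ∀ i, Q i ∈ paramW d n
  -- The shuffle relation is homogeneous: all its terms lie at level `m + k`, so both sides acquire
  -- the same factor `scale ^ (m + k)`.
  · obtain ⟨S, hS⟩ := monomial_mul_monomial (augBasis d b) P Q π ρ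
    choose c hc hcx using fun σ : Fin d → Equiv.Perm (Fin (m + k)) =>
      exists_coordinate (b := b) hν (m + k) σ (Fin.append P Q)
    have hPQ' : ∀ i, Fin.append P Q i ∈ paramW d n := by
      intro i
      induction i using Fin.addCases with
      | left i => rw [Fin.append_left]; exact hPQ.1 i
      | right i => rw [Fin.append_right]; exact hPQ.2 i
    have heq : f * g = ∑ σ ∈ S, c σ := by
      ext x
      obtain ⟨x, rfl⟩ := LipJ.exists_mk b x
      rw [BoundedContinuousFunction.mul_apply, BoundedContinuousFunction.sum_apply, hf, hg]
      simp only [hcx, happly, paramSignature_mk_apply, if_pos hPQ.1, if_pos hPQ.2, if_pos hPQ']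
      rw [← Finset.mul_sum, ← hS, pow_add]
      ring
    rw [heq]
    exact Submodule.sum_mem _ fun σ _ => hc σ
  -- A word with a letter outside `paramW` has coordinate 0 by definition, so one factor vanishes.
  · have heq : f * g = 0 := by
      ext x
      obtain ⟨x, rfl⟩ := LipJ.exists_mk b x
      rw [BoundedContinuousFunction.mul_apply, hf, hg]
      simp only [happly, paramSignature_mk_apply]
      rcases not_and_or.1 hPQ with h | h <;> simp [if_neg h]
    rw [heq]
    exact Submodule.zero_mem _

/-- The algebra of linear combinations of coordinates of the normalized signature. -/
def coordAlgebra (hν : IsGradedNormalization ν) : Subalgebra ℝ (LipJ d b →ᵇ ℝ) :=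
  (coordSpan b ν).toSubalgebra (one_mem_coordSpan hν) fun _ _ => mul_mem_coordSpan hν

theorem coordAlgebra_separates (hν : IsGradedNormalization ν) (x y : LipJ d b) (hxy : x ≠ y) :
    ∃ g ∈ coordAlgebra (b := b) hν, g x ≠ g y := by
  by_contra! h
  refine hxy (paramSignature_injective b (hν.injective (Subtype.ext (funext fun m => ?_))))
  ext π P
  obtain ⟨g, hg, hgx⟩ := exists_coordinate (b := b) hν m π P
  rw [← hgx, ← hgx]
  exact h g hg

theorem exists_inner_of_mem_coordAlgebra (hν : IsGradedNormalization ν) (g : LipJ d b →ᵇ ℝ)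
    (hg : g ∈ coordAlgebra hν) :
    ∃ ℓ : PermHilbert d (d + n), ∀ x, g x = inner ℝ ℓ (ν (paramSignature b x)) := by
  replace hg : g ∈ coordSpan b ν := hg
  induction hg using Submodule.span_induction with
  | mem g hg =>
    obtain ⟨m, π, P, hg⟩ := hg
    obtain ⟨ℓ, hℓ⟩ := exists_inner_eq_apply (N := d + n) m π P
    exact ⟨ℓ, fun x => by rw [hg, hℓ]⟩
  | zero => exact ⟨0, fun x => by simp⟩
  | add f g _ _ hf hg =>
    obtain ⟨ℓ, hℓ⟩ := hf
    obtain ⟨ℓ', hℓ'⟩ := hg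
    exact ⟨ℓ + ℓ', fun x => by rw [inner_add_left, ← hℓ, ← hℓ']; rfl⟩
  | smul a f _ hf =>
    obtain ⟨ℓ, hℓ⟩ := hf
    exact ⟨a • ℓ, fun x => by rw [real_inner_smul_left, ← hℓ]; rfl⟩

end Coordinates

end MapSig

end

/-! ### The theorem -/

theorem theoremB {d n : ℕ} [NeZero d] {V : Type*} [NormedAddCommGroup V] [InnerProductSpace ℝ V]
    (b : OrthonormalBasis (Fin n) ℝ V)
    (ν : MapSig.UnitPermHilbert d (d + n) → MapSig.PermHilbert d (d + n))
    (hν : MapSig.IsGradedNormalization ν) :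
    Continuous (fun x : MapSig.LipJ d b => ν (MapSig.paramSignature b x)) ∧
    Function.Injective (fun x : MapSig.LipJ d b => ν (MapSig.paramSignature b x)) ∧
    (∀ x : MapSig.LipJ d b, ∃ C : ℝ, 0 < C ∧ ∀ m : ℕ,
      (∀ π : Fin d → Equiv.Perm (Fin m),
        ‖(ν (MapSig.paramSignature b x) : ∀ m, MapSig.PermTensor d (d + n) m) m π‖ ≤
          C ^ m / (m.factorial : ℝ) ^ d) ∧
      ‖(ν (MapSig.paramSignature b x) : ∀ m, MapSig.PermTensor d (d + n) m) m‖ ^ 2 ≤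
        C ^ m / (m.factorial : ℝ) ^ d) ∧
    MapSig.IsUniversal (fun x : MapSig.LipJ d b => ν (MapSig.paramSignature b x)) ∧
    MapSig.IsCharacteristic (fun x : MapSig.LipJ d b => ν (MapSig.paramSignature b x)) := by
  have hcont : Continuous fun x : MapSig.LipJ d b => ν (MapSig.paramSignature b x) :=
    hν.continuous.comp (MapSig.continuous_paramSignature b)
  have hb : ∃ C, ∀ x : MapSig.LipJ d b, ‖ν (MapSig.paramSignature b x)‖ ≤ C := by
    obtain ⟨C, -, hC⟩ := hν.bounded
    exact ⟨C, fun x => hC _⟩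
  exact ⟨hcont, hν.injective.comp (MapSig.paramSignature_injective b), MapSig.factorial_decay b hν,
    MapSig.isUniversal_of_subalgebra hcont hb (MapSig.coordAlgebra hν)
      (MapSig.coordAlgebra_separates hν) (MapSig.exists_inner_of_mem_coordAlgebra hν),
    MapSig.isCharacteristic_of_subalgebra hcont hb (MapSig.coordAlgebra hν)
      (MapSig.coordAlgebra_separates hν) (MapSig.exists_inner_of_mem_coordAlgebra hν)⟩
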